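/- Let $n\ge 2$ and $\beta\ge 0$, let $\mathbb{B}\subset\mathbb{R}^n$ be the closed unit ball centred at the origin, $\nu$ the outward unit normal of $\partial\mathbb{B}$, and $\overline\Delta$ the Laplace operator of $\partial\mathbb{B}$ for the induced metric. For $\varsigma\in\mathbb{R}$ consider the Wentzell problem $$\Delta^2u=0\ \text{ in }\mathbb{B},\qquad \partial_\nu u=\partial_\nu(\Delta u)+\beta\overline\Delta u+\varsigma u=0\ \text{ on }\partial\mathbb{B}$$ for real functions $u$ on $\mathbb{B}$ that are of class $C^4$ in the interior and of class $C^3$ up to the boundary. The eigenspace of $\varsigma$ is the vector space of all such solutions $u$; the number $\varsigma$ is an eigenvalue if its eigenspace is nonzero, and its multiplicity is the dimension of its eigenspace. For $k\ge 0$ let $\mathcal{D}_k$ be the space of harmonic homogeneous polynomials of degree $k$ on $\mathbb{R}^n$. Then: (i) the eigenvalues are exactly the numbers $\varsigma_k=k^2(n+2k)+\beta k(k+n-2)$, $k=0,1,2,\dots$; (ii) for every $k\ge 0$ the multiplicity of $\varsigma_k$ is finite and equal to $\dim\mathcal{D}_k$; (iii) for every $k\ge 0$ the eigenspace of $\varsigma_k$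 is $\{-2w+k(|x|^2-1)w : w\in\mathcal{D}_k\}$. -/

import Mathlib

open InnerProductSpace Laplacian Metric

noncomputable section

namespace Wentzell

/-- The closed unit ball of Euclidean `ℝⁿ`, centred at the origin. -/
abbrev unitBall (n : ℕ) : Set (EuclideanSpace ℝ (Fin n)) := closedBall 0 1

/-- The unit sphere of Euclidean `ℝⁿ`, the boundary of `unitBall n`. -/
abbrev unitSphere (n : ℕ) : Set (EuclideanSpace ℝ (Fin n)) := sphere 0 1

/-- The outward normal derivative at a point `x` of the unit sphere of a function on the closed
unit ball: the outward unit normal at `x` is `x` itself, and the derivative is taken within the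
closed ball, so that values outside the ball play no role. -/
def normalDeriv {n : ℕ} (f : EuclideanSpace ℝ (Fin n) → ℝ) (x : EuclideanSpace ℝ (Fin n)) : ℝ :=
  fderivWithin ℝ f (unitBall n) x x

/-- The Laplace operator of the unit sphere (with the metric induced from `ℝⁿ`) applied to the
restriction of `f` to the sphere, at a point `x` of the sphere: the trace of the Riemannian Hessian.
For an orthonormal basis `e₁, …, eₙ₋₁` of the tangent space `x^⊥`, the Hessian in the direction
`eᵢ` is the second derivative at `0` of `f` along the unit speed geodesic starting from `x` with
velocity `eᵢ`, which is the great circle `t ↦ cos t • x + sin t • eᵢ`. -/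
def sphereLaplacian {n : ℕ} (f : EuclideanSpace ℝ (Fin n) → ℝ) (x : EuclideanSpace ℝ (Fin n)) : ℝ :=
  ∑ i, iteratedDeriv 2 (fun t : ℝ => f (Real.cos t • x +
    Real.sin t • (stdOrthonormalBasis ℝ (Submodule.span ℝ {x})ᗮ i : EuclideanSpace ℝ (Fin n)))) 0

/-- `u` is a (classical) solution of the Wentzell problem for the bi-Laplace operator on the closed
unit ball, with parameters `β` and `ς`. The function `u` is of class `C³` up to the boundary and of
class `C⁴` in the interior, the natural regularity for the equations to hold pointwise.
On the sphere, `Δ[unitBall n] u` is the Laplacian of `u` taken within the closed ball. Only the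
values of `u` on the closed ball matter. -/
structure IsSolution (n : ℕ) (β ς : ℝ) (u : EuclideanSpace ℝ (Fin n) → ℝ) : Prop where
  contDiffOn : ContDiffOn ℝ 3 u (unitBall n)
  contDiffOn_interior : ContDiffOn ℝ 4 u (ball 0 1)
  /-- `Δ² u = 0` inside the ball -/
  biharmonic : ∀ x ∈ ball (0 : EuclideanSpace ℝ (Fin n)) 1, Δ (Δ u) x = 0
  /-- `∂_ν u = 0` on the sphere -/
  neumann : ∀ x ∈ unitSphere n, normalDeriv u x = 0
  /-- `∂_ν (Δ u) + β Δ̄ u + ς u = 0` on the sphere -/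
  wentzell : ∀ x ∈ unitSphere n,
    normalDeriv (Δ[unitBall n] u) x + β * sphereLaplacian u x + ς * u x = 0

theorem uniqueDiffOn_unitBall (n : ℕ) : UniqueDiffOn ℝ (unitBall n) := by
  refine uniqueDiffOn_convex (convex_closedBall _ _) ⟨0, ?_⟩
  exact ball_subset_interior_closedBall (mem_ball_self one_pos)

theorem contDiffOn_laplacian {n : ℕ} {u : EuclideanSpace ℝ (Fin n) → ℝ}
    {s : Set (EuclideanSpace ℝ (Fin n))} {m k : ℕ} (hu : ContDiffOn ℝ k u s)
    (hs : UniqueDiffOn ℝ s) (hmk : m + 2 ≤ k) : ContDiffOn ℝ m (Δ[s] u) s := by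
  have h : ∀ x ∈ s, (Δ[s] u) x = ∑ i, iteratedFDerivWithin ℝ 2 u s x
      ![stdOrthonormalBasis ℝ (EuclideanSpace ℝ (Fin n)) i,
        stdOrthonormalBasis ℝ (EuclideanSpace ℝ (Fin n)) i] := fun x hx =>
    laplacianWithin_eq_iteratedFDerivWithin_stdOrthonormalBasis u hs hx
  refine ContDiffOn.congr ?_ h
  refine ContDiffOn.sum fun i _ x hx => ?_
  have h2 : ContDiffWithinAt ℝ m (iteratedFDerivWithin ℝ 2 u s) s x :=
    (hu x hx).iteratedFDerivWithin_right hs (by exact_mod_cast hmk) hx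
  exact (ContinuousMultilinearMap.apply ℝ (fun _ : Fin 2 => EuclideanSpace ℝ (Fin n)) ℝ
    ![stdOrthonormalBasis ℝ (EuclideanSpace ℝ (Fin n)) i,
      stdOrthonormalBasis ℝ (EuclideanSpace ℝ (Fin n)) i]).contDiff.comp_contDiffWithinAt h2

theorem contDiffAt_of_interior {n : ℕ} {u : EuclideanSpace ℝ (Fin n) → ℝ}
    (hu : ContDiffOn ℝ 4 u (ball 0 1)) {x : EuclideanSpace ℝ (Fin n)} (hx : x ∈ ball 0 1) :
    ContDiffAt ℝ 4 u x :=
  hu.contDiffAt (isOpen_ball.mem_nhds hx)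

theorem contDiffAt_laplacian {n : ℕ} {u : EuclideanSpace ℝ (Fin n) → ℝ}
    (hu : ContDiffOn ℝ 4 u (ball 0 1)) {x : EuclideanSpace ℝ (Fin n)} (hx : x ∈ ball 0 1) :
    ContDiffAt ℝ 2 (Δ u) x := by
  have h := contDiffOn_laplacian (m := 2) (k := 4) (by exact_mod_cast hu)
    isOpen_ball.uniqueDiffOn (by norm_num)
  have h1 : ContDiffAt ℝ 2 (Δ[ball 0 1] u) x := by
    exact_mod_cast h.contDiffAt (isOpen_ball.mem_nhds hx)
  refine h1.congr_of_eventuallyEq ?_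
  filter_upwards [isOpen_ball.mem_nhds hx] with y hy
  rw [laplacianWithin_eq_iteratedFDerivWithin_stdOrthonormalBasis u isOpen_ball.uniqueDiffOn hy,
    laplacian_eq_iteratedFDeriv_stdOrthonormalBasis]
  simp only [iteratedFDerivWithin_of_isOpen 2 isOpen_ball hy]

theorem contDiff_comp_circle {n : ℕ} {u : EuclideanSpace ℝ (Fin n) → ℝ}
    (hu : ContDiffOn ℝ 3 u (unitBall n)) {x e : EuclideanSpace ℝ (Fin n)} (hx : ‖x‖ = 1)
    (he : ‖e‖ = 1) (hxe : inner ℝ x e = 0) :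
    ContDiff ℝ 2 (fun t : ℝ => u (Real.cos t • x + Real.sin t • e)) := by
  rw [← contDiffOn_univ]
  refine (hu.of_le (by norm_num)).comp
    (((Real.contDiff_cos.smul contDiff_const).add
      (Real.contDiff_sin.smul contDiff_const)).contDiffOn) fun t _ => ?_
  have h : ‖Real.cos t • x + Real.sin t • e‖ * ‖Real.cos t • x + Real.sin t • e‖ = 1 := by
    rw [norm_add_sq_eq_norm_sq_add_norm_sq_real (by simp [inner_smul_left, inner_smul_right, hxe]),
      norm_smul, norm_smul, hx, he]
    simp only [mul_one, Real.norm_eq_abs, abs_mul_abs_self]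
    nlinarith [Real.sin_sq_add_cos_sq t]
  simp only [unitBall, mem_closedBall, dist_zero_right]
  nlinarith [norm_nonneg (Real.cos t • x + Real.sin t • e)]

theorem contDiff_comp_geodesic {n : ℕ} {u : EuclideanSpace ℝ (Fin n) → ℝ}
    (hu : ContDiffOn ℝ 3 u (unitBall n)) {x : EuclideanSpace ℝ (Fin n)} (hx : x ∈ unitSphere n)
    (i : Fin (Module.finrank ℝ (Submodule.span ℝ {x})ᗮ)) :
    ContDiff ℝ 2 (fun t : ℝ => u (Real.cos t • x + Real.sin t •
      (stdOrthonormalBasis ℝ (Submodule.span ℝ {x})ᗮ i : EuclideanSpace ℝ (Fin n)))) := by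
  refine contDiff_comp_circle hu (by simpa using hx) ?_ ?_
  · exact (stdOrthonormalBasis ℝ (Submodule.span ℝ {x})ᗮ).orthonormal.1 i
  · exact Submodule.mem_orthogonal_singleton_iff_inner_right.1
      (stdOrthonormalBasis ℝ (Submodule.span ℝ {x})ᗮ i).2

theorem differentiableWithinAt_laplacian {n : ℕ} {u : EuclideanSpace ℝ (Fin n) → ℝ}
    (hu : ContDiffOn ℝ 3 u (unitBall n)) {x : EuclideanSpace ℝ (Fin n)} (hx : x ∈ unitBall n) :
    DifferentiableWithinAt ℝ (Δ[unitBall n] u) (unitBall n) x :=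
  (contDiffOn_laplacian (m := 1) (k := 3) (by exact_mod_cast hu) (uniqueDiffOn_unitBall n)
    (by norm_num)).differentiableOn (by norm_num) x hx

theorem IsSolution.add {n : ℕ} {β ς : ℝ} {u v : EuclideanSpace ℝ (Fin n) → ℝ}
    (hu : IsSolution n β ς u) (hv : IsSolution n β ς v) : IsSolution n β ς (u + v) where
  contDiffOn := hu.contDiffOn.add hv.contDiffOn
  contDiffOn_interior := hu.contDiffOn_interior.add hv.contDiffOn_interior
  biharmonic x hx := by
    have h : Δ (u + v) =ᶠ[nhds x] Δ u + Δ v :=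
      ((contDiffAt_of_interior hu.contDiffOn_interior hx).of_le (by norm_num)).laplacian_add_nhds
        ((contDiffAt_of_interior hv.contDiffOn_interior hx).of_le (by norm_num))
    rw [(laplacian_congr_nhds h).eq_of_nhds,
      (contDiffAt_laplacian hu.contDiffOn_interior hx).laplacian_add
        (contDiffAt_laplacian hv.contDiffOn_interior hx), hu.biharmonic x hx, hv.biharmonic x hx,
      add_zero]
  neumann x hx := by
    have hx' : x ∈ unitBall n := sphere_subset_closedBall hx
    have h1 := hu.neumann x hx
    have h2 := hv.neumann x hx
    unfold normalDeriv at *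
    rw [fderivWithin_add (uniqueDiffOn_unitBall n x hx')
      (hu.contDiffOn.differentiableOn (by norm_num) x hx')
      (hv.contDiffOn.differentiableOn (by norm_num) x hx')]
    simp [h1, h2]
  wentzell x hx := by
    have hx' : x ∈ unitBall n := sphere_subset_closedBall hx
    have h1 := hu.wentzell x hx
    have h2 := hv.wentzell x hx
    have e1 : normalDeriv (Δ[unitBall n] (u + v)) x
        = normalDeriv (Δ[unitBall n] u) x + normalDeriv (Δ[unitBall n] v) x := by
      have h : ∀ y ∈ unitBall n, (Δ[unitBall n] (u + v)) y
          = ((Δ[unitBall n] u) + (Δ[unitBall n] v)) y := fun y hy =>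
        ((hu.contDiffOn.of_le (by norm_num)) y hy).laplacianWithin_add
          ((hv.contDiffOn.of_le (by norm_num)) y hy) (uniqueDiffOn_unitBall n) hy
      unfold normalDeriv
      rw [fderivWithin_congr h (h x hx'), fderivWithin_add (uniqueDiffOn_unitBall n x hx')
        (differentiableWithinAt_laplacian hu.contDiffOn hx')
        (differentiableWithinAt_laplacian hv.contDiffOn hx')]
      simp
    have e2 : sphereLaplacian (u + v) x = sphereLaplacian u x + sphereLaplacian v x := by
      unfold sphereLaplacian
      rw [← Finset.sum_add_distrib]
      refine Finset.sum_congr rfl fun i _ => ?_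
      exact iteratedDeriv_fun_add (contDiff_comp_geodesic hu.contDiffOn hx i).contDiffAt
        (contDiff_comp_geodesic hv.contDiffOn hx i).contDiffAt
    rw [e1, e2, Pi.add_apply]
    linear_combination h1 + h2

theorem IsSolution.smul {n : ℕ} {β ς : ℝ} {u : EuclideanSpace ℝ (Fin n) → ℝ} (c : ℝ)
    (hu : IsSolution n β ς u) : IsSolution n β ς (c • u) where
  contDiffOn := contDiffOn_const.smul hu.contDiffOn
  contDiffOn_interior := contDiffOn_const.smul hu.contDiffOn_interior
  biharmonic x hx := by
    have h : Δ (c • u) =ᶠ[nhds x] c • Δ u :=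
      laplacian_smul_nhds c
        ((contDiffAt_of_interior hu.contDiffOn_interior hx).of_le (by norm_num))
    rw [(laplacian_congr_nhds h).eq_of_nhds,
      laplacian_smul c (contDiffAt_laplacian hu.contDiffOn_interior hx), hu.biharmonic x hx,
      smul_zero]
  neumann x hx := by
    have hx' : x ∈ unitBall n := sphere_subset_closedBall hx
    have h1 := hu.neumann x hx
    unfold normalDeriv at *
    rw [fderivWithin_const_smul (uniqueDiffOn_unitBall n x hx')
      (hu.contDiffOn.differentiableOn (by norm_num) x hx') c]
    simp [h1]
  wentzell x hx := by
    have hx' : x ∈ unitBall n := sphere_subset_closedBall hx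
    have h1 := hu.wentzell x hx
    have e1 : normalDeriv (Δ[unitBall n] (c • u)) x = c * normalDeriv (Δ[unitBall n] u) x := by
      have h : ∀ y ∈ unitBall n, (Δ[unitBall n] (c • u)) y = (c • (Δ[unitBall n] u)) y :=
        fun y hy => laplacianWithin_smul c ((hu.contDiffOn.of_le (by norm_num)) y hy)
          (uniqueDiffOn_unitBall n) hy
      unfold normalDeriv
      rw [fderivWithin_congr h (h x hx'), fderivWithin_const_smul
        (uniqueDiffOn_unitBall n x hx') (differentiableWithinAt_laplacian hu.contDiffOn hx') c]
      simp
    have e2 : sphereLaplacian (c • u) x = c * sphereLaplacian u x := by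
      unfold sphereLaplacian
      rw [Finset.mul_sum]
      refine Finset.sum_congr rfl fun i _ => ?_
      exact iteratedDeriv_const_mul_field c _
    rw [e1, e2, Pi.smul_apply, smul_eq_mul]
    linear_combination c * h1

theorem IsSolution.zero (n : ℕ) (β ς : ℝ) : IsSolution n β ς 0 where
  contDiffOn := contDiffOn_const
  contDiffOn_interior := contDiffOn_const
  biharmonic x _ := by
    have h : Δ (0 : EuclideanSpace ℝ (Fin n) → ℝ) = 0 := laplacian_const (c := (0 : ℝ))
    rw [h, h]; rfl
  neumann x _ := by simp [normalDeriv]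
  wentzell x hx := by
    have hL : ∀ y ∈ unitBall n, (Δ[unitBall n] (0 : EuclideanSpace ℝ (Fin n) → ℝ)) y
        = (0 : EuclideanSpace ℝ (Fin n) → ℝ) y := fun y hy => by
      simpa using laplacianWithin_smul (f := (0 : EuclideanSpace ℝ (Fin n) → ℝ)) (0 : ℝ)
        contDiffWithinAt_const (uniqueDiffOn_unitBall n) hy
    have h : normalDeriv (Δ[unitBall n] (0 : EuclideanSpace ℝ (Fin n) → ℝ)) x = 0 := by
      unfold normalDeriv
      rw [fderivWithin_congr hL (hL x (sphere_subset_closedBall hx))]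
      simp
    rw [h]
    simp [sphereLaplacian]

/-- The space of all solutions of the Wentzell problem with parameters `β` and `ς`, as a real vector
space of functions on the closed unit ball. (Such a function is extended by `0` to `ℝⁿ` in order to
take derivatives within the ball; the values of the extension off the ball are irrelevant.) -/
def eigenspace (n : ℕ) (β ς : ℝ) : Submodule ℝ (unitBall n → ℝ) :=
  Submodule.comap (Function.ExtendByZero.linearMap ℝ (Subtype.val : unitBall n → _))
    { carrier := {u | IsSolution n β ς u}
      add_mem' := IsSolution.add
      zero_mem' := IsSolution.zero n β ς
      smul_mem' := fun c _ hu => hu.smul c }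

/-- `ς` is an eigenvalue if the Wentzell problem has a solution which is not identically zero. -/
def IsEigenvalue (n : ℕ) (β ς : ℝ) : Prop := ∃ u ∈ eigenspace n β ς, u ≠ 0

/-- The number `ς_k = k²(n + 2k) + βk(k + n - 2)`. -/
def eigenvalue (n : ℕ) (β : ℝ) (k : ℕ) : ℝ :=
  (k : ℝ) ^ 2 * (n + 2 * k) + β * k * (k + n - 2)

/-- The space `𝒟_k` of harmonic homogeneous polynomials of degree `k` in `n` real variables. -/
def harmonicPoly (n k : ℕ) : Submodule ℝ (MvPolynomial (Fin n) ℝ) :=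
  MvPolynomial.homogeneousSubmodule (Fin n) ℝ k ⊓
    LinearMap.ker (∑ i : Fin n, (MvPolynomial.pderiv i).toLinearMap ∘ₗ
      (MvPolynomial.pderiv (R := ℝ) i).toLinearMap)

end Wentzell

end

/-!
The proof avoids expansions in spherical harmonics: the boundary value problem is turned into an
ordinary differential equation along the rays of the ball.

Write `E = x · ∇` for the Euler operator (`euler`). A biharmonic `u` on the ball has an Almansi
decomposition `u = h + (|x|² - 1) h₂` with harmonic `h` and `h₂` (`exists_almansi`), where `h₂` is
an average of dilates of `Δ u` that solves `4 E h₂ + 2 n h₂ = Δ u`. If `∂_ν u = 0`, then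
`E h + 2 h₂`, which is harmonic since `E` preserves harmonic functions, tends to `0` at the sphere,
so that `h₂ = -½ E h` by the maximum principle. Because `|x|² Δ = E² + (n - 2) E + Δ̄` relates the
Laplacians of space and sphere, the Wentzell condition then says that the harmonic function
`2 E³ h + (n + β) E² h + β (n - 2) E h - ς h` tends to `0` at the sphere as well; hence it vanishes
(`IsSolution.exists_harmonic`). The regularity of `u` up to the boundary enters through the bounds
on `h₂`, `E h₂` and `E² h₂`.

Along each ray, `t ↦ h (t x)` is a solution of an Euler equation with indicial polynomial
`2 j³ + (n + β) j² + β (n - 2) j - ς = ς_j - ς`, and it is smooth at the singular point `t = 0`. So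
it vanishes if `ς` is none of the `ς_j`, and it is a multiple of `t ^ k` if `ς = ς_k`
(`eq_iteratedDeriv_of_euler_equation`), the `ς_j` being distinct for `n ≥ 2` and `β ≥ 0`. In the
latter case `h` is a harmonic homogeneous polynomial of degree `k` and `u = h - ½ (|x|² - 1) k h`.
Smoothness of harmonic functions is Weyl's lemma (`contDiffOn_of_laplacian_eq_zero`).

Conversely `-2w + k(|x|² - 1)w` is a solution by direct computation (`isSolution_eigenfunction`),
and nonzero `w` exist in every degree, the real parts of `(X₀ + i X₁) ^ k`.
-/

namespace Wentzell

open scoped ContDiff Topology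

/-! ### The Euler operator and the Laplacian -/

section Calculus

variable {E : Type*} [NormedAddCommGroup E] [InnerProductSpace ℝ E]

/-- The Euler operator `x · ∇`. -/
noncomputable def euler (f : E → ℝ) (x : E) : ℝ := fderiv ℝ f x x

section Euler

variable {f g : E → ℝ} {s : Set E} {x : E}

theorem contDiffOn_fderiv_of_isOpen {F : Type*} [NormedAddCommGroup F] [NormedSpace ℝ F] {f : E → F}
    (hs : IsOpen s) (hf : ContDiffOn ℝ ∞ f s) :
    ContDiffOn ℝ ∞ (fderiv ℝ f) s :=
  hf.fderiv_of_isOpen hs (by simp)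

theorem contDiffOn_euler (hs : IsOpen s) (hf : ContDiffOn ℝ ∞ f s) :
    ContDiffOn ℝ ∞ (euler f) s :=
  (contDiffOn_fderiv_of_isOpen hs hf).clm_apply contDiffOn_id

theorem _root_.ContDiffOn.contDiffAt_of_isOpen {F : Type*} [NormedAddCommGroup F] [NormedSpace ℝ F]
    {f : E → F} {m : WithTop ℕ∞} (hf : ContDiffOn ℝ m f s) (hs : IsOpen s) (hx : x ∈ s) :
    ContDiffAt ℝ m f x :=
  hf.contDiffAt (hs.mem_nhds hx)

theorem euler_congr (h : f =ᶠ[𝓝 x] g) : euler f x = euler g x := by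
  simp only [euler, h.fderiv_eq]

theorem euler_congr_of_isOpen (hs : IsOpen s) (h : ∀ y ∈ s, f y = g y) (hx : x ∈ s) :
    euler f x = euler g x :=
  euler_congr (by filter_upwards [hs.mem_nhds hx] with y hy using h y hy)

theorem euler_add (hf : DifferentiableAt ℝ f x) (hg : DifferentiableAt ℝ g x) :
    euler (fun y => f y + g y) x = euler f x + euler g x := by
  simp [euler, fderiv_fun_add hf hg]

theorem euler_const_mul (hf : DifferentiableAt ℝ f x) (c : ℝ) :
    euler (fun y => c * f y) x = c * euler f x := by
  simp [euler, fderiv_const_mul hf]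

theorem hasFDerivAt_normSq_sub_one (x : E) :
    HasFDerivAt (fun y : E => ‖y‖ ^ 2 - 1) (2 • innerSL ℝ x) x :=
  (hasStrictFDerivAt_norm_sq x).hasFDerivAt.sub_const 1

theorem contDiff_normSq_sub_one : ContDiff ℝ ∞ (fun y : E => ‖y‖ ^ 2 - 1) :=
  (contDiff_norm_sq ℝ).sub contDiff_const

theorem euler_normSq_sub_one_mul (hf : DifferentiableAt ℝ f x) :
    euler (fun y => (‖y‖ ^ 2 - 1) * f y) x
      = 2 * ‖x‖ ^ 2 * f x + (‖x‖ ^ 2 - 1) * euler f x := by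
  have h := ((hasFDerivAt_normSq_sub_one x).fun_mul hf.hasFDerivAt).fderiv
  simp only [euler]
  rw [h]
  simp
  ring

/-- Differentiating `x · ∇ f` in the direction `v` produces, besides `x · ∇ (∂ᵥ f)`, one extra
copy of `∂ᵥ f`. -/
theorem fderiv_euler_apply (hf : ContDiffAt ℝ 2 f x) (v : E) :
    fderiv ℝ (euler f) x v = euler (fun y => fderiv ℝ f y v) x + fderiv ℝ f x v := by
  have hd : DifferentiableAt ℝ (fderiv ℝ f) x :=
    (hf.fderiv_right (m := 1) (by norm_num)).differentiableAt (by norm_num)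
  have hsymm : IsSymmSndFDerivAt ℝ f x := hf.isSymmSndFDerivAt (by simp)
  have h1 : fderiv ℝ (euler f) x = _ := (hd.hasFDerivAt.clm_apply (hasFDerivAt_id x)).fderiv
  have h2 : fderiv ℝ (fun y => fderiv ℝ f y v) x = _ :=
    (hd.hasFDerivAt.clm_apply (hasFDerivAt_const v x)).fderiv
  rw [h1]
  simp only [euler, h2]
  simp [hsymm.eq v x, add_comm]

/-- The second derivative in the radial direction, in terms of the Euler operator. -/
theorem fderiv_fderiv_apply_self (hf : ContDiffAt ℝ 2 f x) :
    fderiv ℝ (fderiv ℝ f) x x x = euler (euler f) x - euler f x := by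
  have hd : DifferentiableAt ℝ (fderiv ℝ f) x :=
    (hf.fderiv_right (m := 1) (by norm_num)).differentiableAt (by norm_num)
  have h1 : fderiv ℝ (euler f) x = _ := (hd.hasFDerivAt.clm_apply (hasFDerivAt_id x)).fderiv
  have : euler (euler f) x = fderiv ℝ (euler f) x x := rfl
  rw [this, h1]
  simp [euler]

end Euler

section Laplacian

variable [FiniteDimensional ℝ E] {f g : E → ℝ} {s : Set E} {x : E}

theorem laplacian_apply {ι : Type*} [Fintype ι] (b : OrthonormalBasis ι ℝ E) (f : E → ℝ) (x : E) :
    Δ f x = ∑ i, fderiv ℝ (fderiv ℝ f) x (b i) (b i) := by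
  simp [laplacian_eq_iteratedFDeriv_orthonormalBasis f b, iteratedFDeriv_two_apply]

theorem laplacian_eq_sum_fderiv {ι : Type*} [Fintype ι] (b : OrthonormalBasis ι ℝ E)
    (hf : ContDiffAt ℝ 2 f x) :
    Δ f x = ∑ i, fderiv ℝ (fun y => fderiv ℝ f y (b i)) x (b i) := by
  have hd : DifferentiableAt ℝ (fderiv ℝ f) x :=
    (hf.fderiv_right (m := 1) (by norm_num)).differentiableAt (by norm_num)
  rw [laplacian_apply b]
  refine Finset.sum_congr rfl fun i _ => ?_
  rw [(hd.hasFDerivAt.clm_apply (hasFDerivAt_const (b i) x)).fderiv]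
  simp

/-- The commutator of the Laplacian with the Euler operator is twice the Laplacian. -/
theorem laplacian_euler (hs : IsOpen s) (hf : ContDiffOn ℝ ∞ f s) (hx : x ∈ s) :
    Δ (euler f) x = euler (Δ f) x + 2 * Δ f x := by
  have hat : ∀ {F : Type _} [NormedAddCommGroup F] [NormedSpace ℝ F] {k : E → F},
      ContDiffOn ℝ ∞ k s → ∀ {y : E}, y ∈ s → ContDiffAt ℝ 2 k y := fun hk y hy =>
    (hk.contDiffAt_of_isOpen hs hy).of_le (by norm_cast)
  let b := stdOrthonormalBasis ℝ E
  have hD (v : E) : ContDiffOn ℝ ∞ (fun y => fderiv ℝ f y v) s :=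
    (contDiffOn_fderiv_of_isOpen hs hf).clm_apply contDiffOn_const
  have hDD (v : E) : ContDiffOn ℝ ∞ (fun y => fderiv ℝ (fun z => fderiv ℝ f z v) y v) s :=
    (contDiffOn_fderiv_of_isOpen hs (hD v)).clm_apply contDiffOn_const
  have key (v : E) : fderiv ℝ (fun y => fderiv ℝ (euler f) y v) x v
      = euler (fun y => fderiv ℝ (fun z => fderiv ℝ f z v) y v) x
        + 2 * fderiv ℝ (fun z => fderiv ℝ f z v) x v := by
    have h1 : (fun y => fderiv ℝ (euler f) y v)
        =ᶠ[𝓝 x] fun y => euler (fun z => fderiv ℝ f z v) y + fderiv ℝ f y v := by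
      filter_upwards [hs.mem_nhds hx] with y hy using fderiv_euler_apply (hat hf hy) v
    rw [h1.fderiv_eq, fderiv_fun_add
      ((hat (contDiffOn_euler hs (hD v)) hx).differentiableAt (by norm_num))
      ((hat (hD v) hx).differentiableAt (by norm_num)), add_apply,
      fderiv_euler_apply (hat (hD v) hx) v]
    ring
  rw [laplacian_eq_sum_fderiv b (hat (contDiffOn_euler hs hf) hx),
    laplacian_eq_sum_fderiv b (hat hf hx),
    euler_congr_of_isOpen hs (fun y hy => laplacian_eq_sum_fderiv b (hat hf hy)) hx]
  simp only [euler]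
  rw [fderiv_fun_sum fun i _ => (hat (hDD (b i)) hx).differentiableAt (by norm_num)]
  simp only [sum_apply, Finset.mul_sum, ← Finset.sum_add_distrib]
  exact Finset.sum_congr rfl fun i _ => key (b i)

theorem laplacian_normSq_sub_one_mul (hf : ContDiffAt ℝ 2 f x) :
    Δ (fun y => (‖y‖ ^ 2 - 1) * f y : E → ℝ) x
      = 2 * Module.finrank ℝ E * f x + 4 * euler f x + (‖x‖ ^ 2 - 1) * Δ f x := by
  let b := stdOrthonormalBasis ℝ E
  have hev : ∀ᶠ y in 𝓝 x, ContDiffAt ℝ 2 f y := hf.eventually (by simp)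
  have hprod : ContDiffAt ℝ 2 (fun y : E => (‖y‖ ^ 2 - 1) * f y) x :=
    (contDiff_normSq_sub_one.contDiffAt.of_le (by norm_cast)).mul hf
  have hd : DifferentiableAt ℝ (fderiv ℝ f) x :=
    (hf.fderiv_right (m := 1) (by norm_num)).differentiableAt (by norm_num)
  have key (v : E) : fderiv ℝ (fun y => fderiv ℝ (fun y => (‖y‖ ^ 2 - 1) * f y) y v) x v
      = 2 * inner ℝ v v * f x + 4 * (inner ℝ x v * fderiv ℝ f x v)
        + (‖x‖ ^ 2 - 1) * fderiv ℝ (fun y => fderiv ℝ f y v) x v := by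
    have h1 : (fun y => fderiv ℝ (fun y => (‖y‖ ^ 2 - 1) * f y) y v)
        =ᶠ[𝓝 x] fun y => (‖y‖ ^ 2 - 1) * fderiv ℝ f y v + f y * (2 * innerSL ℝ v y) := by
      filter_upwards [hev] with y hy
      rw [((hasFDerivAt_normSq_sub_one y).fun_mul
        (hy.differentiableAt (by norm_num)).hasFDerivAt).fderiv]
      simp [real_inner_comm]
    have hl : DifferentiableAt ℝ (fun y => fderiv ℝ f y v) x :=
      hd.clm_apply (differentiableAt_const v)
    rw [h1.fderiv_eq, (((hasFDerivAt_normSq_sub_one x).fun_mul hl.hasFDerivAt).fun_add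
      ((hf.differentiableAt (by norm_num)).hasFDerivAt.fun_mul
        ((innerSL ℝ v).hasFDerivAt.const_mul 2))).fderiv]
    simp only [add_apply, smul_apply, smul_eq_mul,
      innerSL_apply_apply, nsmul_eq_mul, real_inner_comm v x]
    push_cast
    ring
  rw [laplacian_eq_sum_fderiv b hprod, laplacian_eq_sum_fderiv b hf,
    Finset.sum_congr rfl fun i _ => key (b i)]
  have he : ∑ i, inner ℝ x (b i) * fderiv ℝ f x (b i) = euler f x := by
    have h := congrArg (fderiv ℝ f x) (b.sum_repr x)
    rw [map_sum] at h
    rw [euler, ← h]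
    refine Finset.sum_congr rfl fun i _ => ?_
    rw [map_smul, b.repr_apply_apply, smul_eq_mul, real_inner_comm]
  simp only [Finset.sum_add_distrib, ← Finset.mul_sum, he]
  congr 2
  simp
  ring

end Laplacian

end Calculus

/-! ### Weyl's lemma and the maximum principle -/

section Weyl

open MeasureTheory Set

variable {E : Type*} [NormedAddCommGroup E] [InnerProductSpace ℝ E]

/-- There is a nonnegative radial test function `φ`, supported in a given ball about the origin,
such that the field `-φ(y) y` is the gradient of a test function `ψ` supported in the same ball:
`φ(y) = b(‖y‖²)` for a bump function `b` on the line, and `ψ(y) = ½ ∫ b` over `s ≥ ‖y‖²`. -/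
theorem exists_radial_bump {r : ℝ} (hr : 0 < r) :
    ∃ φ ψ : E → ℝ, ContDiff ℝ ∞ φ ∧ (∀ y, 0 ≤ φ y) ∧ φ 0 ≠ 0 ∧ (∀ y, φ (-y) = φ y) ∧
      (∀ y, r ≤ ‖y‖ → φ y = 0) ∧ (∀ y, r ≤ ‖y‖ → ψ y = 0) ∧
      ∀ y, HasFDerivAt ψ (-(φ y) • innerSL ℝ y) y := by
  have hr2 : 0 < r ^ 2 := by positivity
  let b : ContDiffBump (0 : ℝ) := ⟨r ^ 2 / 2, r ^ 2, by positivity, by linarith⟩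
  have hb0 (s : ℝ) (hs : r ^ 2 ≤ s) : b s = 0 := b.zero_of_le_dist (by
    rw [Real.dist_eq, sub_zero]; exact hs.trans (le_abs_self s))
  have hle (y : E) (hy : r ≤ ‖y‖) : r ^ 2 ≤ ‖y‖ ^ 2 := by gcongr
  refine ⟨fun y => b (‖y‖ ^ 2), fun y => -(1 / 2) * ∫ t in (r ^ 2)..(‖y‖ ^ 2), b t,
    b.contDiff.comp (contDiff_norm_sq ℝ), fun y => b.nonneg, ?_, fun y => by simp, fun y hy =>
      hb0 _ (hle y hy), fun y hy => ?_, fun y => ?_⟩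
  · have : b ((‖(0 : E)‖) ^ 2) = 1 := b.one_of_mem_closedBall (by
      simpa using b.rIn_pos.le)
    change b (‖(0 : E)‖ ^ 2) ≠ 0
    rw [this]
    exact one_ne_zero
  · have h : ∫ t in (r ^ 2)..(‖y‖ ^ 2), b t = ∫ t in (r ^ 2)..(‖y‖ ^ 2), (0 : ℝ) := by
      refine intervalIntegral.integral_congr fun t ht => hb0 t ?_
      rw [uIcc_of_le (hle y hy)] at ht
      exact ht.1
    simp only [h]
    simp
  · have h1 : HasDerivAt (fun s => ∫ t in (r ^ 2)..s, b t) (b (‖y‖ ^ 2)) (‖y‖ ^ 2) :=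
      intervalIntegral.integral_hasDerivAt_right (b.continuous.intervalIntegrable _ _)
        (b.continuous.stronglyMeasurableAtFilter _ _) b.continuous.continuousAt
    have h2 :=
      (h1.comp_hasFDerivAt y (hasStrictFDerivAt_norm_sq y).hasFDerivAt).const_mul (-(1 / 2))
    refine h2.congr_fderiv ?_
    ext v
    simp
    ring

variable [FiniteDimensional ℝ E] [MeasurableSpace E] [BorelSpace E]

/-- A weighted mean value property. The mean `M(ε) = ∫ F(x + ε y) φ(y) dy` has derivative
`∫ ∇F(x + ε y) · y φ(y) dy`, and since `-φ(y) y = ∇ψ(y)`, an integration by parts turns it into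
`ε ∫ ΔF(x + ε y) ψ(y) dy = 0`. So `M` takes the same value at `0` and at `1`. -/
theorem integral_mul_radial_eq {r : ℝ} {φ ψ : E → ℝ} (hφ : ContDiff ℝ ∞ φ)
    (hφr : ∀ y, r ≤ ‖y‖ → φ y = 0) (hψr : ∀ y, r ≤ ‖y‖ → ψ y = 0)
    (hψ : ∀ y, HasFDerivAt ψ (-(φ y) • innerSL ℝ y) y) {F : E → ℝ} (hF : ContDiff ℝ 2 F)
    (hFc : HasCompactSupport F) {x : E} (hΔ : ∀ y, ‖y‖ < r → Δ F (x + y) = 0) :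
    ∫ y, F (x + y) * φ y = F x * ∫ y, φ y := by
  have hφc : HasCompactSupport φ := HasCompactSupport.intro (isCompact_closedBall 0 r)
    fun y hy => hφr y (by by_contra! h; exact hy (by simpa using h.le))
  have hψc : HasCompactSupport ψ := HasCompactSupport.intro (isCompact_closedBall 0 r)
    fun y hy => hψr y (by by_contra! h; exact hy (by simpa using h.le))
  have hψcont : Continuous ψ := continuous_iff_continuousAt.2 fun y => (hψ y).continuousAt
  have hDF : ContDiff ℝ 1 (fderiv ℝ F) := hF.fderiv_right (by norm_num)
  obtain ⟨C, hC⟩ := (hFc.fderiv ℝ).exists_bound_of_continuous hDF.continuous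
  have hint {g : E → ℝ} (hg : Continuous g) : Integrable (fun y => g y * φ y) :=
    (hg.mul hφ.continuous).integrable_of_hasCompactSupport hφc.mul_left
  have hder (ε : ℝ) : HasDerivAt (fun ε : ℝ => ∫ y, F (x + ε • y) * φ y)
      (∫ y, fderiv ℝ F (x + ε • y) y * φ y) ε := by
    refine (hasDerivAt_integral_of_dominated_loc_of_deriv_le (s := univ)
      (F := fun (ε : ℝ) y => F (x + ε • y) * φ y)
      (F' := fun (ε : ℝ) y => fderiv ℝ F (x + ε • y) y * φ y)
      (bound := fun y => C * ‖‖y‖ * φ y‖) Filter.univ_mem ?_ ?_ ?_ ?_ ?_ ?_).2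
    · exact Filter.Eventually.of_forall fun ε => (hint (by fun_prop)).aestronglyMeasurable
    · exact hint (by fun_prop)
    · exact (hint ((hDF.continuous.comp (by fun_prop)).clm_apply
        continuous_id)).aestronglyMeasurable
    · refine Filter.Eventually.of_forall fun y ε _ => ?_
      rw [norm_mul, norm_mul, norm_norm, ← mul_assoc]
      exact mul_le_mul_of_nonneg_right (((fderiv ℝ F (x + ε • y)).le_opNorm y).trans
        (mul_le_mul_of_nonneg_right (hC _) (norm_nonneg y))) (norm_nonneg _)
    · exact (hint continuous_norm).norm.const_mul C
    · refine Filter.Eventually.of_forall fun y ε _ => ?_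
      have h1 : HasDerivAt (fun ε : ℝ => x + ε • y) y ε := by
        simpa using ((hasDerivAt_id ε).smul_const y).const_add x
      exact ((hF.differentiable (by norm_num) _).hasFDerivAt.comp_hasDerivAt ε h1).mul_const _
  let b := stdOrthonormalBasis ℝ E
  have hzero (ε : ℝ) (h0 : 0 ≤ ε) (h1 : ε ≤ 1) : ∫ y, fderiv ℝ F (x + ε • y) y * φ y = 0 := by
    have hG (v : E) : ContDiff ℝ 1 (fun y => fderiv ℝ F (x + ε • y) v) :=
      (hDF.comp (by fun_prop)).clm_apply contDiff_const
    have hGd (v y : E) : fderiv ℝ (fun y => fderiv ℝ F (x + ε • y) v) y v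
        = ε * fderiv ℝ (fderiv ℝ F) (x + ε • y) v v := by
      have h2 : HasFDerivAt (fun y : E => x + ε • y) (ε • ContinuousLinearMap.id ℝ E) y :=
        ((hasFDerivAt_id y).const_smul ε).const_add x
      have h3 := ((hDF.differentiable (by norm_num) (x + ε • y)).hasFDerivAt.comp y h2).clm_apply
        (hasFDerivAt_const v y)
      have h4 : fderiv ℝ (fun y => fderiv ℝ F (x + ε • y) v) y = _ := h3.fderiv
      rw [h4]
      simp
    have hsplit (y : E) : fderiv ℝ F (x + ε • y) y * φ y
        = -∑ i, fderiv ℝ F (x + ε • y) (b i) * fderiv ℝ ψ y (b i) := by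
      have h := congrArg (fderiv ℝ F (x + ε • y)) (b.sum_repr y)
      rw [map_sum] at h
      rw [← h, Finset.sum_mul, ← Finset.sum_neg_distrib]
      refine Finset.sum_congr rfl fun i _ => ?_
      rw [map_smul, b.repr_apply_apply, (hψ y).fderiv]
      simp [real_inner_comm]
      ring
    have hψd : Continuous (fderiv ℝ ψ) := by
      have : fderiv ℝ ψ = fun y => -(φ y) • innerSL ℝ y := funext fun y => (hψ y).fderiv
      rw [this]
      exact hφ.continuous.neg.smul (innerSL ℝ).continuous
    have hI (v : E) : Integrable fun y => fderiv ℝ F (x + ε • y) v * fderiv ℝ ψ y v :=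
      ((hG v).continuous.mul (hψd.clm_apply continuous_const)).integrable_of_hasCompactSupport
        (HasCompactSupport.mul_left (hψc.fderiv_apply ℝ v))
    have hI' (v : E) : Integrable
        fun y => fderiv ℝ (fun y => fderiv ℝ F (x + ε • y) v) y v * ψ y :=
      ((((hG v).continuous_fderiv (by norm_num)).clm_apply continuous_const).mul
        hψcont).integrable_of_hasCompactSupport hψc.mul_left
    have hparts (v : E) : ∫ y, fderiv ℝ F (x + ε • y) v * fderiv ℝ ψ y v
        = -∫ y, fderiv ℝ (fun y => fderiv ℝ F (x + ε • y) v) y v * ψ y :=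
      integral_mul_fderiv_eq_neg_fderiv_mul_of_integrable (hI' v) (hI v)
        (((hG v).continuous.mul hψcont).integrable_of_hasCompactSupport hψc.mul_left)
        (fun y _ => (hG v).differentiable (by norm_num) y) (fun y _ => (hψ y).differentiableAt)
    simp only [hsplit]
    rw [integral_neg, integral_finsetSum _ fun i _ => hI (b i)]
    simp only [hparts, Finset.sum_neg_distrib, neg_neg]
    rw [← integral_finsetSum _ fun i _ => hI' (b i)]
    refine integral_eq_zero_of_ae (Filter.Eventually.of_forall fun y => ?_)
    simp only [hGd, ← Finset.sum_mul, ← Finset.mul_sum, ← laplacian_apply b, Pi.zero_apply]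
    rcases lt_or_ge ‖y‖ r with hy | hy
    · rw [hΔ (ε • y)]
      · ring
      · rw [norm_smul, Real.norm_of_nonneg h0]
        exact (mul_le_of_le_one_left (norm_nonneg y) h1).trans_lt hy
    · rw [hψr y hy, mul_zero]
  have hconst := constant_of_has_deriv_right_zero (a := 0) (b := 1)
    (fun ε _ => (hder ε).continuousAt.continuousWithinAt)
    (fun ε hε => by
      have h := (hder ε).hasDerivWithinAt (s := Ici ε)
      rwa [hzero ε hε.1 hε.2.le] at h) 1 (right_mem_Icc.2 zero_le_one)
  simpa [integral_const_mul] using hconst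

/-- **Weyl's lemma** for `C²` functions: a harmonic function is smooth. Near a given point the
function, cut off, equals its convolution with a radial test function. -/
theorem contDiffOn_of_laplacian_eq_zero {f : E → ℝ} {s : Set E} (hs : IsOpen s)
    (hf : ContDiffOn ℝ 2 f s) (hΔ : ∀ x ∈ s, Δ f x = 0) : ContDiffOn ℝ ∞ f s := by
  intro x₀ hx₀
  obtain ⟨R, hR, hRs⟩ := Metric.isOpen_iff.1 hs x₀ hx₀
  let χ : ContDiffBump x₀ := ⟨R / 2, 3 * R / 4, by positivity, by linarith⟩
  have hχs : tsupport χ ⊆ s := by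
    rw [χ.tsupport_eq]
    exact (closedBall_subset_ball (by change 3 * R / 4 < R; linarith)).trans hRs
  let F : E → ℝ := fun y => χ y * f y
  have hFc : HasCompactSupport F := χ.hasCompactSupport.mul_right
  have hF : ContDiff ℝ 2 F := by
    refine contDiff_iff_contDiffAt.2 fun y => ?_
    by_cases hy : y ∈ tsupport χ
    · exact (χ.contDiff.contDiffAt).mul (hf.contDiffAt (hs.mem_nhds (hχs hy)))
    · refine (contDiffAt_const (c := (0 : ℝ))).congr_of_eventuallyEq ?_
      filter_upwards [(isClosed_tsupport χ).isOpen_compl.mem_nhds hy] with z hz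
      simp [F, image_eq_zero_of_notMem_tsupport hz]
  have hFf (y : E) (hy : y ∈ ball x₀ (R / 2)) : F =ᶠ[𝓝 y] f := by
    filter_upwards [isOpen_ball.mem_nhds hy] with z hz
    simp [F, χ.one_of_mem_closedBall (ball_subset_closedBall hz)]
  obtain ⟨φ, ψ, hφ, hφ0, hφ1, hφn, hφr, hψr, hψ⟩ := exists_radial_bump (E := E) (r := R / 4)
    (by positivity)
  have hφc : HasCompactSupport φ := HasCompactSupport.intro (isCompact_closedBall 0 (R / 4))
    fun y hy => hφr y (by by_contra! h; exact hy (by simpa using h.le))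
  have hpos : 0 < ∫ y, φ y :=
    hφ.continuous.integral_pos_of_hasCompactSupport_nonneg_nonzero hφc hφ0 hφ1
  have hmean (x : E) (hx : x ∈ ball x₀ (R / 4)) :
      f x = (∫ y, φ y)⁻¹ * (convolution F φ (ContinuousLinearMap.mul ℝ ℝ) volume) x := by
    have hx' : x ∈ ball x₀ (R / 2) := ball_subset_ball (by linarith) hx
    have h1 := integral_mul_radial_eq hφ hφr hψr hψ hF hFc (x := x) fun y hy => by
      have hxy : x + y ∈ ball x₀ (R / 2) := by
        rw [mem_ball, dist_eq_norm] at hx ⊢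
        calc ‖x + y - x₀‖ = ‖(x - x₀) + y‖ := by congr 1; abel
          _ ≤ ‖x - x₀‖ + ‖y‖ := norm_add_le _ _
          _ < R / 2 := by linarith
      rw [(laplacian_congr_nhds (hFf _ hxy)).eq_of_nhds]
      exact hΔ _ (hRs (ball_subset_ball (by linarith) hxy))
    rw [convolution_eq_swap]
    have h2 : ∫ y, (ContinuousLinearMap.mul ℝ ℝ) (F (x - y)) (φ y) = ∫ y, F (x + y) * φ y := by
      rw [← integral_neg_eq_self]
      simp [hφn]
    rw [h2, h1, (hFf x hx').eq_of_nhds]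
    field_simp
  have hconv : ContDiff ℝ ∞ (convolution F φ (ContinuousLinearMap.mul ℝ ℝ) volume) :=
    hφc.contDiff_convolution_right _ (hF.continuous.integrable_of_hasCompactSupport
      hFc).locallyIntegrable hφ
  have hev : f =ᶠ[𝓝 x₀] fun x =>
      (∫ y, φ y)⁻¹ * (convolution F φ (ContinuousLinearMap.mul ℝ ℝ) volume) x := by
    filter_upwards [isOpen_ball.mem_nhds (mem_ball_self (x := x₀) (by positivity : 0 < R / 4))]
      with x hx using hmean x hx
  exact ((contDiff_const.mul hconv).contDiffAt.congr_of_eventuallyEq hev).contDiffWithinAt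

end Weyl

section MaximumPrinciple

open Set

/-- At a local maximum the second derivative is nonpositive. -/
theorem deriv_deriv_nonpos_of_isLocalMax {g : ℝ → ℝ} {t : ℝ} (hg : ContinuousAt g t)
    (h : IsLocalMax g t) : deriv (deriv g) t ≤ 0 := by
  by_contra! hpos
  have hmin := isLocalMin_of_deriv_deriv_pos hpos h.deriv_eq_zero hg
  have hc : g =ᶠ[𝓝 t] fun _ => g t := by
    filter_upwards [h, hmin] with s h1 h2 using le_antisymm h1 h2
  have : deriv (deriv g) t = 0 := by
    rw [hc.deriv.deriv_eq]
    simp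
  linarith

variable {E : Type*} [NormedAddCommGroup E] [InnerProductSpace ℝ E] [FiniteDimensional ℝ E]

theorem laplacian_nonpos_of_isLocalMax {f : E → ℝ} {x : E} (hf : ContDiffAt ℝ 2 f x)
    (h : IsLocalMax f x) : Δ f x ≤ 0 := by
  rw [laplacian_apply (stdOrthonormalBasis ℝ E)]
  refine Finset.sum_nonpos fun i _ => ?_
  set v := stdOrthonormalBasis ℝ E i
  have hline (t : ℝ) : HasDerivAt (fun t : ℝ => x + t • v) v t := by
    simpa using ((hasDerivAt_id t).smul_const v).const_add x
  have hcont : ContinuousAt (fun t : ℝ => x + t • v) 0 := (hline 0).continuousAt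
  have hx0 : x + (0 : ℝ) • v = x := by simp
  have hd : DifferentiableAt ℝ (fderiv ℝ f) x :=
    (hf.fderiv_right (m := 1) (by norm_num)).differentiableAt (by norm_num)
  have h1 : deriv (fun t : ℝ => f (x + t • v)) =ᶠ[𝓝 0] fun t => fderiv ℝ f (x + t • v) v := by
    have hev : ∀ᶠ y in 𝓝 (x + (0 : ℝ) • v), ContDiffAt ℝ 2 f y := by
      rw [hx0]
      exact hf.eventually (by simp)
    filter_upwards [hcont.eventually hev] with t ht
    exact ((ht.differentiableAt (by norm_num)).hasFDerivAt.comp_hasDerivAt t (hline t)).deriv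
  have h2 : deriv (deriv fun t : ℝ => f (x + t • v)) 0 = fderiv ℝ (fderiv ℝ f) x v v := by
    rw [h1.deriv_eq]
    have hd' : HasFDerivAt (fderiv ℝ f) (fderiv ℝ (fderiv ℝ f) x) (x + (0 : ℝ) • v) := by
      rw [hx0]; exact hd.hasFDerivAt
    have h3 : HasDerivAt (fun t : ℝ => fderiv ℝ f (x + t • v)) (fderiv ℝ (fderiv ℝ f) x v) 0 :=
      hd'.comp_hasDerivAt (0 : ℝ) (hline 0)
    have h4 := (h3.clm_apply (hasDerivAt_const (0 : ℝ) v)).deriv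
    rw [h4]
    simp
  rw [← h2]
  refine deriv_deriv_nonpos_of_isLocalMax ?_ ?_
  · exact ContinuousAt.comp (by rw [hx0]; exact hf.continuousAt) hcont
  · have : ∀ᶠ y in 𝓝 (x + (0 : ℝ) • v), f y ≤ f x := by rw [hx0]; exact h
    filter_upwards [hcont.eventually this] with t ht
    simpa using ht

/-- **Maximum principle** on the unit ball, for a harmonic function that is dominated near the
sphere by a continuous function vanishing there. -/
theorem nonpos_of_laplacian_eq_zero [Nontrivial E] {H G : E → ℝ}
    (hH : ContDiffOn ℝ 2 H (ball 0 1))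
    (hΔ : ∀ x ∈ ball (0 : E) 1, Δ H x = 0) (hG : ContinuousOn G (closedBall 0 1))
    (hG0 : ∀ x ∈ sphere (0 : E) 1, G x = 0) (hHG : ∀ x ∈ ball (0 : E) 1, H x ≤ G x) {x : E}
    (hx : x ∈ ball (0 : E) 1) : H x ≤ 0 := by
  by_contra! ha
  set a := H x with ha_def
  -- `K` is strictly subharmonic, yet it attains its maximum over the ball: off the compact subset
  -- `C` of the open ball it is less than its value at `x`
  let K : E → ℝ := fun y => H y + (‖y‖ ^ 2 - 1) * (a / 4)
  let C : Set E := closedBall 0 1 ∩ G ⁻¹' Ici (a / 2)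
  have hCc : IsCompact C := by
    refine (isCompact_closedBall (0 : E) 1).of_isClosed_subset ?_ inter_subset_left
    exact hG.preimage_isClosed_of_isClosed isClosed_closedBall isClosed_Ici
  have hCb : C ⊆ ball 0 1 := by
    rintro y ⟨hy1, hy2⟩
    rcases (mem_closedBall.1 hy1).lt_or_eq with h | h
    · exact h
    · have := hG0 y h
      simp only [mem_preimage, mem_Ici, this] at hy2
      linarith
  have hxC : x ∈ C := ⟨ball_subset_closedBall hx, by
    have := hHG x hx
    simp only [mem_preimage, mem_Ici]
    linarith⟩
  have hp : ContDiff ℝ 2 (fun y : E => (‖y‖ ^ 2 - 1) * (a / 4)) :=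
    (contDiff_normSq_sub_one.of_le (by norm_cast)).mul contDiff_const
  have hK : ContDiffOn ℝ 2 K (ball 0 1) := hH.add hp.contDiffOn
  obtain ⟨y, hyC, hy⟩ := hCc.exists_isMaxOn ⟨x, hxC⟩ (hK.continuousOn.mono hCb)
  have hyb := hCb hyC
  have hKle (z : E) (hz : z ∈ ball (0 : E) 1) : (‖z‖ ^ 2 - 1) * (a / 4) ≤ 0 ∧
      -(a / 4) ≤ (‖z‖ ^ 2 - 1) * (a / 4) := by
    have h1 : ‖z‖ ^ 2 ≤ 1 := by
      have := (mem_ball_zero_iff.1 hz).le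
      exact pow_le_one₀ (norm_nonneg z) this
    constructor <;> nlinarith [sq_nonneg ‖z‖]
  have hmax : IsLocalMax K y := by
    filter_upwards [isOpen_ball.mem_nhds hyb] with z hz
    by_cases hzC : z ∈ C
    · exact hy hzC
    · have h1 : G z < a / 2 := by
        by_contra! h
        exact hzC ⟨ball_subset_closedBall hz, h⟩
      have h2 : K x ≤ K y := hy hxC
      have h3 := hHG z hz
      have h4 := hKle z hz
      have h5 := hKle x hx
      simp only [K] at h2 ⊢
      linarith
  have h1 := laplacian_nonpos_of_isLocalMax (hK.contDiffAt_of_isOpen isOpen_ball hyb) hmax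
  have h2 : Δ K y = Δ H y + Δ (fun y => (‖y‖ ^ 2 - 1) * (a / 4) : E → ℝ) y :=
    (hH.contDiffAt_of_isOpen isOpen_ball hyb).laplacian_add hp.contDiffAt
  rw [h2, hΔ y hyb, laplacian_normSq_sub_one_mul (f := fun _ => a / 4) contDiffAt_const,
    laplacian_const] at h1
  have h3 : euler (fun _ : E => a / 4) y = 0 := by simp [euler]
  have h4 : 0 < (Module.finrank ℝ E : ℝ) := by exact_mod_cast Module.finrank_pos
  rw [h3] at h1
  simp only [Pi.zero_apply, mul_zero, add_zero, zero_add] at h1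
  nlinarith [mul_pos h4 ha]

theorem eq_zero_of_laplacian_eq_zero [Nontrivial E] {H G : E → ℝ}
    (hH : ContDiffOn ℝ 2 H (ball 0 1))
    (hΔ : ∀ x ∈ ball (0 : E) 1, Δ H x = 0) (hG : ContinuousOn G (closedBall 0 1))
    (hG0 : ∀ x ∈ sphere (0 : E) 1, G x = 0) (hHG : ∀ x ∈ ball (0 : E) 1, |H x| ≤ G x) {x : E}
    (hx : x ∈ ball (0 : E) 1) : H x = 0 := by
  refine le_antisymm (nonpos_of_laplacian_eq_zero hH hΔ hG hG0
    (fun y hy => (abs_le.1 (hHG y hy)).2) hx) ?_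
  have h := nonpos_of_laplacian_eq_zero (H := -H) hH.neg (fun y hy => by
    rw [laplacian_neg]; simp [hΔ y hy]) hG hG0
    (fun y hy => by have := (abs_le.1 (hHG y hy)).1; simp only [Pi.neg_apply]; linarith) hx
  simpa using h

end MaximumPrinciple

/-! ### Averages of dilates -/

section DilationAverage

open MeasureTheory Set

/-- The average `x ↦ ∫₀¹ w(s) V(s² x) ds` of the dilates of a function on the unit ball. The
dilation factor `s²` keeps the weights needed for inverting `4 x · ∇ + 2 n` polynomial, whatever
the parity of the dimension `n`. -/
noncomputable def dilationAverage {E F : Type*} [NormedAddCommGroup E] [NormedSpace ℝ E]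
    [NormedAddCommGroup F] [NormedSpace ℝ F] (w : ℝ → ℝ) (V : E → F) (x : E) : F :=
  ∫ s in (0 : ℝ)..1, w s • V (s ^ 2 • x)

section NormedSpace

variable {E F : Type*} [NormedAddCommGroup E] [NormedSpace ℝ E] [NormedAddCommGroup F]
  [NormedSpace ℝ F] {w : ℝ → ℝ} {V : E → F} {x : E}

theorem sq_smul_mem_closedBall {ρ s : ℝ} (hs : s ∈ Icc (0 : ℝ) 1) (hx : x ∈ closedBall (0 : E) ρ) :
    s ^ 2 • x ∈ closedBall (0 : E) ρ := by
  rw [mem_closedBall_zero_iff] at hx ⊢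
  rw [norm_smul, Real.norm_of_nonneg (sq_nonneg s)]
  exact (mul_le_of_le_one_left (norm_nonneg x) (pow_le_one₀ hs.1 hs.2)).trans hx

theorem sq_smul_mem_ball {s : ℝ} (hs : s ∈ Icc (0 : ℝ) 1) (hx : x ∈ ball (0 : E) 1) :
    s ^ 2 • x ∈ ball (0 : E) 1 := by
  have h := sq_smul_mem_closedBall (x := x) (ρ := ‖x‖) hs (by simp)
  rw [mem_closedBall_zero_iff] at h
  rw [mem_ball_zero_iff] at hx ⊢
  exact h.trans_lt hx

theorem continuousOn_dilates (hw : Continuous w) (hV : ContinuousOn V (ball 0 1))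
    (hx : x ∈ ball (0 : E) 1) : ContinuousOn (fun s : ℝ => w s • V (s ^ 2 • x)) (Icc 0 1) :=
  hw.continuousOn.smul (hV.comp (by fun_prop) fun _ hs => sq_smul_mem_ball hs hx)

theorem intervalIntegrable_dilates (hw : Continuous w) (hV : ContinuousOn V (ball 0 1))
    (hx : x ∈ ball (0 : E) 1) :
    IntervalIntegrable (fun s : ℝ => w s • V (s ^ 2 • x)) volume 0 1 :=
  ContinuousOn.intervalIntegrable (by
    rw [uIcc_of_le zero_le_one]; exact continuousOn_dilates hw hV hx)

theorem aestronglyMeasurable_dilates (hw : Continuous w) (hV : ContinuousOn V (ball 0 1))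
    (hx : x ∈ ball (0 : E) 1) :
    AEStronglyMeasurable (fun s : ℝ => w s • V (s ^ 2 • x)) (volume.restrict (uIoc (0 : ℝ) 1)) :=
  (intervalIntegrable_iff.1 (intervalIntegrable_dilates hw hV hx)).aestronglyMeasurable

theorem hasFDerivAt_dilationAverage [FiniteDimensional ℝ E] (hw : Continuous w)
    (hV : ContDiffOn ℝ 1 V (ball 0 1)) (hx : x ∈ ball (0 : E) 1) :
    HasFDerivAt (dilationAverage w V)
      (dilationAverage (fun s => w s * s ^ 2) (fderiv ℝ V) x) x := by
  obtain ⟨ρ, hxρ, hρ⟩ := exists_between (mem_ball_zero_iff.1 hx)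
  have hsub : closedBall (0 : E) ρ ⊆ ball 0 1 := closedBall_subset_ball hρ
  have hDV : ContinuousOn (fderiv ℝ V) (ball 0 1) :=
    hV.continuousOn_fderiv_of_isOpen isOpen_ball le_rfl
  obtain ⟨C, hC⟩ := (isCompact_closedBall (0 : E) ρ).exists_bound_of_continuousOn (hDV.mono hsub)
  have hw2 : Continuous fun s => w s * s ^ 2 := by fun_prop
  refine intervalIntegral.hasFDerivAt_integral_of_dominated_of_fderiv_le (s := ball 0 ρ)
    (F := fun x s => w s • V (s ^ 2 • x))
    (F' := fun x s => (w s * s ^ 2) • fderiv ℝ V (s ^ 2 • x))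
    (bound := fun s => ‖w s * s ^ 2‖ * C)
    (isOpen_ball.mem_nhds (mem_ball_zero_iff.2 hxρ)) ?_
    (intervalIntegrable_dilates hw hV.continuousOn hx)
    (aestronglyMeasurable_dilates hw2 hDV hx) ?_
    ((hw2.norm.mul continuous_const).intervalIntegrable _ _) ?_
  · filter_upwards [isOpen_ball.mem_nhds hx] with y hy
    exact aestronglyMeasurable_dilates hw hV.continuousOn hy
  · refine Filter.Eventually.of_forall fun s hs y hy => ?_
    rw [uIoc_of_le zero_le_one] at hs
    rw [norm_smul]
    exact mul_le_mul_of_nonneg_left (hC _ (sq_smul_mem_closedBall (Ioc_subset_Icc_self hs)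
      (ball_subset_closedBall hy))) (norm_nonneg _)
  · refine Filter.Eventually.of_forall fun s hs y hy => ?_
    rw [uIoc_of_le zero_le_one] at hs
    have hy1 : s ^ 2 • y ∈ ball (0 : E) 1 := sq_smul_mem_ball (Ioc_subset_Icc_self hs)
      (hsub (ball_subset_closedBall hy))
    have h1 := ((hV.contDiffAt (isOpen_ball.mem_nhds hy1)).differentiableAt
      (by norm_num)).hasFDerivAt.comp y ((hasFDerivAt_id (𝕜 := ℝ) y).const_smul (s ^ 2))
    refine (h1.const_smul (w s)).congr_fderiv ?_
    ext v
    simp [mul_smul]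

theorem abs_dilationAverage_le {V : E → ℝ} {d : ℕ} {C : ℝ} (hC : ∀ y ∈ ball (0 : E) 1, |V y| ≤ C)
    (hx : x ∈ ball (0 : E) 1) :
    |dilationAverage (fun s => s ^ (d - 1) / 2) V x| ≤ C := by
  have h := intervalIntegral.norm_integral_le_of_norm_le_const (a := 0) (b := 1) (C := C)
    (f := fun s => (s ^ (d - 1) / 2) • V (s ^ 2 • x)) fun s hs => by
      rw [uIoc_of_le zero_le_one] at hs
      have h1 : s ^ (d - 1) ≤ 1 := pow_le_one₀ hs.1.le hs.2
      have h2 : 0 ≤ s ^ (d - 1) := pow_nonneg hs.1.le _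
      rw [norm_smul, Real.norm_of_nonneg (by positivity)]
      exact (mul_le_of_le_one_left (norm_nonneg _) (by linarith)).trans
        (hC _ (sq_smul_mem_ball (Ioc_subset_Icc_self hs) hx))
  simpa [dilationAverage] using h

end NormedSpace

/-- One derivative of `V` is given up, for a proof by induction on `m` that differentiates under the
integral. The types are in the same universe since the induction passes from `F` to `E →L[ℝ] F`. -/
theorem contDiffOn_nat_dilationAverage {E : Type} [NormedAddCommGroup E] [NormedSpace ℝ E]
    [FiniteDimensional ℝ E] (m : ℕ) {F : Type} [NormedAddCommGroup F] [NormedSpace ℝ F]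
    {w : ℝ → ℝ} {V : E → F} (hw : Continuous w) (hV : ContDiffOn ℝ (m + 1) V (ball 0 1)) :
    ContDiffOn ℝ m (dilationAverage w V) (ball 0 1) := by
  induction m generalizing F w with
  | zero =>
    refine contDiffOn_zero.2 fun x hx => ?_
    exact (hasFDerivAt_dilationAverage hw (hV.of_le (by simp))
      hx).continuousAt.continuousWithinAt
  | succ m ih =>
    have hd (x : E) (hx : x ∈ ball (0 : E) 1) := hasFDerivAt_dilationAverage hw
      (hV.of_le (by norm_cast; simp)) hx
    have hV' : ContDiffOn ℝ (m + 1) (fderiv ℝ V) (ball 0 1) :=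
      hV.fderiv_of_isOpen isOpen_ball (by norm_cast)
    push_cast
    rw [contDiffOn_succ_iff_fderiv_of_isOpen isOpen_ball]
    refine ⟨fun x hx => (hd x hx).differentiableAt.differentiableWithinAt, by simp, ?_⟩
    exact (ih (w := fun s => w s * s ^ 2) (by fun_prop) hV').congr fun x hx => (hd x hx).fderiv

variable {E : Type} [NormedAddCommGroup E] [InnerProductSpace ℝ E] [FiniteDimensional ℝ E]
  {w : ℝ → ℝ} {V : E → ℝ} {x : E}

theorem contDiffOn_dilationAverage (hw : Continuous w) (hV : ContDiffOn ℝ ∞ V (ball 0 1)) :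
    ContDiffOn ℝ ∞ (dilationAverage w V) (ball 0 1) :=
  contDiffOn_infty.2 fun m =>
    contDiffOn_nat_dilationAverage m hw (hV.of_le (by norm_cast; exact le_top))

theorem laplacian_dilationAverage_eq_zero (hw : Continuous w) (hV : ContDiffOn ℝ ∞ V (ball 0 1))
    (hΔ : ∀ y ∈ ball (0 : E) 1, Δ V y = 0) (hx : x ∈ ball (0 : E) 1) :
    Δ (dilationAverage w V) x = 0 := by
  have hw2 : Continuous fun s => w s * s ^ 2 := by fun_prop
  have hw4 : Continuous fun s => w s * s ^ 2 * s ^ 2 := by fun_prop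
  have hDV := contDiffOn_fderiv_of_isOpen isOpen_ball hV
  have hDDV := contDiffOn_fderiv_of_isOpen isOpen_ball hDV
  have h1 : fderiv ℝ (dilationAverage w V)
      =ᶠ[𝓝 x] dilationAverage (fun s => w s * s ^ 2) (fderiv ℝ V) := by
    filter_upwards [isOpen_ball.mem_nhds hx] with y hy
    exact (hasFDerivAt_dilationAverage hw (hV.of_le (by norm_cast)) hy).fderiv
  let b := stdOrthonormalBasis ℝ E
  have hint := intervalIntegrable_dilates hw4 hDDV.continuousOn hx
  rw [laplacian_apply b, h1.fderiv_eq,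
    (hasFDerivAt_dilationAverage hw2 (hDV.of_le (by norm_cast)) hx).fderiv]
  have h2 (v : E) : dilationAverage (fun s => w s * s ^ 2 * s ^ 2) (fderiv ℝ (fderiv ℝ V)) x v v
      = ∫ s in (0 : ℝ)..1,
        w s * s ^ 2 * s ^ 2 * fderiv ℝ (fderiv ℝ V) (s ^ 2 • x) v v := by
    let L : (E →L[ℝ] E →L[ℝ] ℝ) →L[ℝ] ℝ :=
      (ContinuousLinearMap.apply ℝ ℝ v).comp (ContinuousLinearMap.apply ℝ (E →L[ℝ] ℝ) v)
    exact (L.intervalIntegral_comp_comm hint).symm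
  simp only [h2]
  rw [← intervalIntegral.integral_finsetSum]
  · rw [intervalIntegral.integral_congr (g := fun _ => (0 : ℝ))]
    · simp
    · intro s hs
      rw [uIcc_of_le zero_le_one] at hs
      simp only [← Finset.mul_sum, ← laplacian_apply b]
      rw [hΔ _ (sq_smul_mem_ball hs hx), mul_zero]
  · intro i _
    exact intervalIntegrable_dilates hw4
      ((hDDV.continuousOn.clm_apply continuousOn_const).clm_apply continuousOn_const) hx

/-- The average with weight `½ s^(d-1)` inverts the operator `4 x · ∇ + 2 d`. -/
theorem euler_dilationAverage {d : ℕ} (hd : 1 ≤ d) (hV : ContDiffOn ℝ ∞ V (ball 0 1))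
    (hx : x ∈ ball (0 : E) 1) :
    4 * euler (dilationAverage (fun s => s ^ (d - 1) / 2) V) x
      + 2 * d * dilationAverage (fun s => s ^ (d - 1) / 2) V x = V x := by
  have hDV := contDiffOn_fderiv_of_isOpen isOpen_ball hV
  have hw : Continuous fun s : ℝ => s ^ (d - 1) / 2 := by fun_prop
  have hw2 : Continuous fun s : ℝ => s ^ (d - 1) / 2 * s ^ 2 := by fun_prop
  have hint1 : IntervalIntegrable (fun s : ℝ => s ^ (d - 1) / 2 * V (s ^ 2 • x)) volume 0 1 :=
    intervalIntegrable_dilates hw hV.continuousOn hx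
  have hint2 := intervalIntegrable_dilates hw2 hDV.continuousOn hx
  have hint3 : IntervalIntegrable (fun s : ℝ => s ^ (d - 1) / 2 * s ^ 2 *
      fderiv ℝ V (s ^ 2 • x) x) volume 0 1 :=
    intervalIntegrable_dilates hw2 (hDV.continuousOn.clm_apply continuousOn_const) hx
  have h1 : euler (dilationAverage (fun s => s ^ (d - 1) / 2) V) x
      = ∫ s in (0 : ℝ)..1, s ^ (d - 1) / 2 * s ^ 2 * fderiv ℝ V (s ^ 2 • x) x := by
    rw [euler, (hasFDerivAt_dilationAverage hw (hV.of_le (by norm_cast)) hx).fderiv]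
    exact ((ContinuousLinearMap.apply ℝ ℝ x).intervalIntegral_comp_comm hint2).symm
  have hderiv (s : ℝ) (hs : s ∈ uIcc (0 : ℝ) 1) : HasDerivAt (fun s : ℝ => s ^ d * V (s ^ 2 • x))
      (4 * (s ^ (d - 1) / 2 * s ^ 2 * fderiv ℝ V (s ^ 2 • x) x)
        + 2 * d * (s ^ (d - 1) / 2 * V (s ^ 2 • x))) s := by
    rw [uIcc_of_le zero_le_one] at hs
    have h2 : HasDerivAt (fun s : ℝ => s ^ 2 • x) ((2 * s) • x) s := by
      simpa using (hasDerivAt_pow 2 s).smul_const x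
    have h3 := ((hV.contDiffAt (isOpen_ball.mem_nhds
      (sq_smul_mem_ball hs hx))).differentiableAt (by simp)).hasFDerivAt.comp_hasDerivAt s h2
    refine ((hasDerivAt_pow d s).fun_mul h3).congr_deriv ?_
    obtain ⟨e, rfl⟩ := Nat.exists_eq_add_of_le' hd
    simp only [map_smul, smul_eq_mul, Function.comp_apply, Nat.add_sub_cancel]
    ring
  have h4 := intervalIntegral.integral_eq_sub_of_hasDerivAt hderiv
    ((hint3.const_mul 4).add (hint1.const_mul (2 * d)))
  rw [intervalIntegral.integral_add (hint3.const_mul 4) (hint1.const_mul (2 * d)),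
    intervalIntegral.integral_const_mul] at h4
  have h5 : ∫ s in (0 : ℝ)..1, 2 * (d : ℝ) * (s ^ (d - 1) / 2 * V (s ^ 2 • x))
      = 2 * d * dilationAverage (fun s => s ^ (d - 1) / 2) V x :=
    intervalIntegral.integral_const_mul _ _
  rw [h1, ← h5, h4]
  simp [show d ≠ 0 by omega]

end DilationAverage

/-! ### The Laplacian of the sphere -/

section Sphere

open Set

variable {n : ℕ} {f g : EuclideanSpace ℝ (Fin n) → ℝ} {x : EuclideanSpace ℝ (Fin n)}

theorem laplacianWithin_apply {ι : Type*} [Fintype ι]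
    (b : OrthonormalBasis ι ℝ (EuclideanSpace ℝ (Fin n))) (f : EuclideanSpace ℝ (Fin n) → ℝ)
    (hx : x ∈ unitBall n) :
    (Δ[unitBall n] f) x = ∑ i,
      fderivWithin ℝ (fderivWithin ℝ f (unitBall n)) (unitBall n) x (b i) (b i) := by
  rw [laplacianWithin_eq_iteratedFDerivWithin_orthonormalBasis f (uniqueDiffOn_unitBall n) hx b]
  refine Finset.sum_congr rfl fun i _ => ?_
  rw [iteratedFDerivWithin_two_apply f (uniqueDiffOn_unitBall n) hx]
  simp

theorem great_circle_mem_unitSphere {e : EuclideanSpace ℝ (Fin n)} (hx : ‖x‖ = 1) (he : ‖e‖ = 1)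
    (hxe : inner ℝ x e = 0) (t : ℝ) : Real.cos t • x + Real.sin t • e ∈ unitSphere n := by
  have h : ‖Real.cos t • x + Real.sin t • e‖ * ‖Real.cos t • x + Real.sin t • e‖ = 1 := by
    rw [norm_add_sq_eq_norm_sq_add_norm_sq_real (by simp [inner_smul_left, inner_smul_right, hxe]),
      norm_smul, norm_smul, hx, he]
    simp only [mul_one, Real.norm_eq_abs, abs_mul_abs_self]
    nlinarith [Real.sin_sq_add_cos_sq t]
  simp only [unitSphere, mem_sphere_zero_iff_norm]
  nlinarith [norm_nonneg (Real.cos t • x + Real.sin t • e)]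

/-- The second derivative along a great circle is the second derivative in the tangent direction
minus the normal derivative. -/
theorem iteratedDeriv_two_great_circle (hf : ContDiffOn ℝ 2 f (unitBall n))
    {e : EuclideanSpace ℝ (Fin n)} (hx : ‖x‖ = 1) (he : ‖e‖ = 1) (hxe : inner ℝ x e = 0) :
    iteratedDeriv 2 (fun t : ℝ => f (Real.cos t • x + Real.sin t • e)) 0
      = fderivWithin ℝ (fderivWithin ℝ f (unitBall n)) (unitBall n) x e e
        - fderivWithin ℝ f (unitBall n) x x := by
  have hmem (t : ℝ) : Real.cos t • x + Real.sin t • e ∈ unitBall n :=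
    sphere_subset_closedBall (great_circle_mem_unitSphere hx he hxe t)
  have hc (t : ℝ) : HasDerivAt (fun t : ℝ => Real.cos t • x + Real.sin t • e)
      (-Real.sin t • x + Real.cos t • e) t :=
    ((Real.hasDerivAt_cos t).smul_const x).add ((Real.hasDerivAt_sin t).smul_const e)
  have hc' (t : ℝ) : HasDerivAt (fun t : ℝ => -Real.sin t • x + Real.cos t • e)
      (-Real.cos t • x + -Real.sin t • e) t :=
    ((Real.hasDerivAt_sin t).neg.smul_const x).add ((Real.hasDerivAt_cos t).smul_const e)
  have hcomp {F : Type} [NormedAddCommGroup F] [NormedSpace ℝ F]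
      {k : EuclideanSpace ℝ (Fin n) → F} (hk : DifferentiableOn ℝ k (unitBall n)) (t : ℝ) :
      HasDerivAt (fun t : ℝ => k (Real.cos t • x + Real.sin t • e))
        (fderivWithin ℝ k (unitBall n) (Real.cos t • x + Real.sin t • e)
          (-Real.sin t • x + Real.cos t • e)) t := by
    have h := ((hk _ (hmem t)).hasFDerivWithinAt).comp_hasDerivWithinAt (s := univ) t
      (hc t).hasDerivWithinAt fun s _ => hmem s
    exact hasDerivWithinAt_univ.1 h
  have hd : DifferentiableOn ℝ f (unitBall n) := hf.differentiableOn (by norm_num)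
  have hd' : DifferentiableOn ℝ (fderivWithin ℝ f (unitBall n)) (unitBall n) :=
    (hf.fderivWithin (m := 1) (uniqueDiffOn_unitBall n) (by norm_num)).differentiableOn
      (by norm_num)
  have h1 : deriv (fun t : ℝ => f (Real.cos t • x + Real.sin t • e)) = fun t =>
      fderivWithin ℝ f (unitBall n) (Real.cos t • x + Real.sin t • e)
        (-Real.sin t • x + Real.cos t • e) := funext fun t => (hcomp hd t).deriv
  rw [iteratedDeriv_succ, iteratedDeriv_one, h1, ((hcomp hd' 0).clm_apply (hc' 0)).deriv]
  simp [sub_eq_add_neg]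

/-- The decomposition of the Laplacian at a point of the sphere into its tangential and its radial
part. -/
theorem sphereLaplacian_eq (hf : ContDiffOn ℝ 2 f (unitBall n)) (hx : x ∈ unitSphere n) :
    sphereLaplacian f x = (Δ[unitBall n] f) x
      - fderivWithin ℝ (fderivWithin ℝ f (unitBall n)) (unitBall n) x x x
      - (n - 1) * fderivWithin ℝ f (unitBall n) x x := by
  have hx1 : ‖x‖ = 1 := by simpa using hx
  have hx0 : x ≠ 0 := by rintro rfl; simp at hx1
  let b := stdOrthonormalBasis ℝ (Submodule.span ℝ {x})ᗮ
  have he (i) : ‖(b i : EuclideanSpace ℝ (Fin n))‖ = 1 := b.orthonormal.1 i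
  have hxe (i) : inner ℝ x (b i : EuclideanSpace ℝ (Fin n)) = 0 :=
    Submodule.mem_orthogonal_singleton_iff_inner_right.1 (b i).2
  have hrank : Module.finrank ℝ (Submodule.span ℝ {x})ᗮ + 1 = n := by
    have h := Submodule.finrank_add_finrank_orthogonal (Submodule.span ℝ {x})
    rw [finrank_span_singleton hx0, finrank_euclideanSpace, Fintype.card_fin] at h
    omega
  -- complete `x` to an orthonormal basis of the whole space
  let v : Option (Fin (Module.finrank ℝ (Submodule.span ℝ {x})ᗮ)) → EuclideanSpace ℝ (Fin n) :=
    fun o => o.elim x fun i => (b i : EuclideanSpace ℝ (Fin n))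
  have hv : Orthonormal ℝ v := by
    refine ⟨fun o => ?_, fun o o' hne => ?_⟩
    · cases o with
      | none => exact hx1
      | some i => exact he i
    · cases o with
      | none =>
        cases o' with
        | none => exact absurd rfl hne
        | some j => exact hxe j
      | some i =>
        cases o' with
        | none => exact (real_inner_comm _ _).trans (hxe i)
        | some j => exact b.orthonormal.2 fun h => hne (congrArg some h)
  let B := basisOfOrthonormalOfCardEqFinrank hv (by
    rw [Fintype.card_option, Fintype.card_fin, hrank, finrank_euclideanSpace, Fintype.card_fin])
  have hB : ⇑B = v := coe_basisOfOrthonormalOfCardEqFinrank hv _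
  let OB := B.toOrthonormalBasis (by rw [hB]; exact hv)
  have hOB : ⇑OB = v := (B.coe_toOrthonormalBasis _).trans hB
  have hsum : sphereLaplacian f x = ∑ i,
      (fderivWithin ℝ (fderivWithin ℝ f (unitBall n)) (unitBall n) x (b i) (b i)
        - fderivWithin ℝ f (unitBall n) x x) :=
    Finset.sum_congr rfl fun i _ => iteratedDeriv_two_great_circle hf hx1 (he i) (hxe i)
  rw [hsum, laplacianWithin_apply OB f (sphere_subset_closedBall hx), Fintype.sum_option, hOB,
    Finset.sum_sub_distrib]
  have hn : (Module.finrank ℝ (Submodule.span ℝ {x})ᗮ : ℝ) = n - 1 := by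
    rw [eq_sub_iff_add_eq]
    exact_mod_cast hrank
  simp [v, hn]

theorem sphereLaplacian_congr (h : ∀ y ∈ unitSphere n, f y = g y) (hx : x ∈ unitSphere n) :
    sphereLaplacian f x = sphereLaplacian g x := by
  refine Finset.sum_congr rfl fun i _ =>
    congrArg (fun k => iteratedDeriv 2 k 0) (funext fun t => ?_)
  exact h _ (great_circle_mem_unitSphere (by simpa using hx)
    ((stdOrthonormalBasis ℝ (Submodule.span ℝ {x})ᗮ).orthonormal.1 i)
    (Submodule.mem_orthogonal_singleton_iff_inner_right.1
      (stdOrthonormalBasis ℝ (Submodule.span ℝ {x})ᗮ i).2) t)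

theorem laplacianWithin_congr (h : ∀ y ∈ unitBall n, f y = g y) (hx : x ∈ unitBall n) :
    (Δ[unitBall n] f) x = (Δ[unitBall n] g) x :=
  (laplacianWithin_congr_nhdsWithin (Filter.eventuallyEq_of_mem self_mem_nhdsWithin h)
    (uniqueDiffOn_unitBall n)).eq_of_nhdsWithin hx

theorem normalDeriv_congr (h : ∀ y ∈ unitBall n, f y = g y) (hx : x ∈ unitBall n) :
    normalDeriv f x = normalDeriv g x := by
  rw [normalDeriv, normalDeriv, fderivWithin_congr h (h x hx)]

theorem IsSolution.congr {β ς : ℝ} (hf : IsSolution n β ς f) (h : ∀ y ∈ unitBall n, g y = f y) :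
    IsSolution n β ς g where
  contDiffOn := hf.contDiffOn.congr h
  contDiffOn_interior := hf.contDiffOn_interior.congr fun y hy => h y (ball_subset_closedBall hy)
  biharmonic y hy := by
    have h1 : g =ᶠ[𝓝 y] f := by
      filter_upwards [isOpen_ball.mem_nhds hy] with z hz using h z (ball_subset_closedBall hz)
    rw [(laplacian_congr_nhds (laplacian_congr_nhds h1)).eq_of_nhds, hf.biharmonic y hy]
  neumann y hy := by
    rw [normalDeriv_congr h (sphere_subset_closedBall hy), hf.neumann y hy]
  wentzell y hy := by
    rw [normalDeriv_congr (fun z hz => laplacianWithin_congr h hz) (sphere_subset_closedBall hy),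
      sphereLaplacian_congr (fun z hz => h z (sphere_subset_closedBall hz)) hy,
      h y (sphere_subset_closedBall hy), hf.wentzell y hy]

theorem laplacianWithin_eq_laplacian_of_mem_ball (f : EuclideanSpace ℝ (Fin n) → ℝ)
    (hx : x ∈ ball 0 1) : (Δ[unitBall n] f) x = Δ f x := by
  rw [laplacianWithin_eq_iteratedFDerivWithin_stdOrthonormalBasis f (uniqueDiffOn_unitBall n)
    (ball_subset_closedBall hx), laplacian_eq_iteratedFDeriv_stdOrthonormalBasis]
  have h : unitBall n =ᶠ[𝓝 x] univ := by
    filter_upwards [isOpen_ball.mem_nhds hx] with y hy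
    exact eq_true (ball_subset_closedBall hy)
  simp only [iteratedFDerivWithin_congr_set h, iteratedFDerivWithin_univ]

theorem fderivWithin_eq_fderiv_of_mem_ball {F : Type*} [NormedAddCommGroup F] [NormedSpace ℝ F]
    (k : EuclideanSpace ℝ (Fin n) → F) (hx : x ∈ ball 0 1) :
    fderivWithin ℝ k (unitBall n) x = fderiv ℝ k x :=
  fderivWithin_of_mem_nhds (Filter.mem_of_superset (isOpen_ball.mem_nhds hx) ball_subset_closedBall)

end Sphere

/-! ### Euler equations that are singular at the origin -/

section EulerODE

open Set

variable {f g : ℝ → ℝ} {s : Set ℝ}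

theorem euler_real (f : ℝ → ℝ) (t : ℝ) : euler f t = t * deriv f t := by
  simp [euler]

theorem contDiffOn_iteratedDeriv (hs : IsOpen s) (hf : ContDiffOn ℝ ∞ f s) (j : ℕ) :
    ContDiffOn ℝ ∞ (iteratedDeriv j f) s := by
  induction j with
  | zero => simpa using hf
  | succ j ih =>
    rw [iteratedDeriv_succ]
    exact ih.deriv_of_isOpen hs (by simp)

theorem iteratedDeriv_euler (hs : IsOpen s) (hf : ContDiffOn ℝ ∞ f s) (j : ℕ) :
    ∀ t ∈ s, iteratedDeriv j (euler f) t
      = t * iteratedDeriv (j + 1) f t + j * iteratedDeriv j f t := by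
  induction j with
  | zero => intro t _; simp [euler_real]
  | succ j ih =>
    intro t ht
    have hd (i : ℕ) : DifferentiableAt ℝ (iteratedDeriv i f) t :=
      ((contDiffOn_iteratedDeriv hs hf i).contDiffAt_of_isOpen hs ht).differentiableAt (by simp)
    have h1 : iteratedDeriv j (euler f)
        =ᶠ[𝓝 t] fun t => t * iteratedDeriv (j + 1) f t + j * iteratedDeriv j f t := by
      filter_upwards [hs.mem_nhds ht] with r hr using ih r hr
    rw [iteratedDeriv_succ, h1.deriv_eq,
      (((hasDerivAt_id' t).fun_mul (hd (j + 1)).hasDerivAt).fun_add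
      ((hd j).hasDerivAt.const_mul (j : ℝ))).deriv, iteratedDeriv_succ (n := j + 1),
      iteratedDeriv_succ (n := j)]
    push_cast
    ring

theorem iteratedDeriv_euler_zero (hs : IsOpen s) (h0 : (0 : ℝ) ∈ s) (hf : ContDiffOn ℝ ∞ f s)
    (j : ℕ) : iteratedDeriv j (euler f) 0 = j * iteratedDeriv j f 0 := by
  rw [iteratedDeriv_euler hs hf j 0 h0, zero_mul, zero_add]

/-- A function all of whose derivatives vanish at `0` is smaller than any power of `t`. -/
theorem exists_abs_le_mul_pow (hs : IsOpen s) (h01 : Icc 0 1 ⊆ s) (hf : ContDiffOn ℝ ∞ f s)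
    (hflat : ∀ j, iteratedDeriv j f 0 = 0) (N : ℕ) :
    ∃ C, 0 ≤ C ∧ ∀ t ∈ Icc (0 : ℝ) 1, |f t| ≤ C * t ^ N := by
  induction N generalizing f with
  | zero =>
    obtain ⟨C, hC⟩ := isCompact_Icc.exists_bound_of_continuousOn (hf.continuousOn.mono h01)
    exact ⟨C, (norm_nonneg _).trans (hC 0 (left_mem_Icc.2 zero_le_one)), fun t ht => by
      simpa using hC t ht⟩
  | succ N ih =>
    obtain ⟨C, hC0, hC⟩ := ih (hf.deriv_of_isOpen hs (by simp)) fun j => by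
      rw [← iteratedDeriv_succ']
      exact hflat _
    refine ⟨C, hC0, fun t ht => ?_⟩
    have hsub : Icc 0 t ⊆ Icc 0 1 := Icc_subset_Icc_right ht.2
    have h := Convex.norm_image_sub_le_of_norm_deriv_le (f := f) (s := Icc 0 t) (C := C * t ^ N)
      (fun r hr => (hf.contDiffAt_of_isOpen hs (h01 (hsub hr))).differentiableAt (by simp))
      (fun r hr => (hC r (hsub hr)).trans (by gcongr; exacts [hr.1, hr.2]))
      (convex_Icc 0 t) (left_mem_Icc.2 ht.1) (right_mem_Icc.2 ht.1)
    have h0 : f 0 = 0 := by simpa using hflat 0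
    rw [h0, sub_zero, sub_zero, Real.norm_eq_abs, Real.norm_of_nonneg ht.1] at h
    rw [pow_succ, ← mul_assoc]
    exact h

/-- Uniqueness at the singular point `0` of a third order Euler equation: for
`Φ = f² + (θf)² + (θ²f)²`, where `θ = t d/dt`, the equation gives `θΦ ≤ NΦ`, so that `t^(-N) Φ` is
nonincreasing. As it tends to `0` at `0`, it vanishes. -/
theorem eq_zero_of_euler_equation {b c ς : ℝ} (hs : IsOpen s) (h01 : Icc 0 1 ⊆ s)
    (hf : ContDiffOn ℝ ∞ f s) (hflat : ∀ j, iteratedDeriv j f 0 = 0)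
    (heq : ∀ t ∈ s, 2 * euler (euler (euler f)) t + b * euler (euler f) t + c * euler f t
      = ς * f t) : f 1 = 0 := by
  have h0 : (0 : ℝ) ∈ s := h01 (left_mem_Icc.2 zero_le_one)
  set f1 := euler f with hf1
  set f2 := euler f1 with hf2
  have hs1 : ContDiffOn ℝ ∞ f1 s := contDiffOn_euler hs hf
  have hs2 : ContDiffOn ℝ ∞ f2 s := contDiffOn_euler hs hs1
  have hflat1 (j) : iteratedDeriv j f1 0 = 0 := by
    rw [hf1, iteratedDeriv_euler_zero hs h0 hf, hflat, mul_zero]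
  have hflat2 (j) : iteratedDeriv j f2 0 = 0 := by
    rw [hf2, iteratedDeriv_euler_zero hs h0 hs1, hflat1, mul_zero]
  obtain ⟨N, hN⟩ := exists_nat_ge (2 + |b| + |c| + |ς|)
  obtain ⟨C0, hC0, hb0⟩ := exists_abs_le_mul_pow hs h01 hf hflat (N + 1)
  obtain ⟨C1, hC1, hb1⟩ := exists_abs_le_mul_pow hs h01 hs1 hflat1 (N + 1)
  obtain ⟨C2, hC2, hb2⟩ := exists_abs_le_mul_pow hs h01 hs2 hflat2 (N + 1)
  let Φ : ℝ → ℝ := fun t => f t ^ 2 + f1 t ^ 2 + f2 t ^ 2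
  let Φ' : ℝ → ℝ := fun t => 2 * f t * deriv f t + 2 * f1 t * deriv f1 t + 2 * f2 t * deriv f2 t
  have hd {k : ℝ → ℝ} (hk : ContDiffOn ℝ ∞ k s) {t : ℝ} (ht : t ∈ s) :
      HasDerivAt (fun t => k t ^ 2) (2 * k t * deriv k t) t := by
    simpa using (((hk.contDiffAt_of_isOpen hs ht).differentiableAt (by simp)).hasDerivAt).fun_pow 2
  have hΦ {t : ℝ} (ht : t ∈ s) : HasDerivAt Φ (Φ' t) t :=
    ((hd hf ht).fun_add (hd hs1 ht)).fun_add (hd hs2 ht)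
  have hΦ' {t : ℝ} (ht : t ∈ s) : t * Φ' t ≤ N * Φ t := by
    have e0 : t * deriv f t = f1 t := (euler_real f t).symm
    have e1 : t * deriv f1 t = f2 t := (euler_real f1 t).symm
    have e2 : t * deriv f2 t = euler f2 t := (euler_real f2 t).symm
    have e3 := heq t ht
    have h1 : t * Φ' t = 2 * f t * f1 t + 2 * f1 t * f2 t
        + f2 t * (ς * f t - b * f2 t - c * f1 t) := by
      simp only [Φ']
      linear_combination 2 * f t * e0 + 2 * f1 t * e1 + 2 * f2 t * e2 + f2 t * e3
    have p (a x y : ℝ) : a * (x * y) ≤ |a| * (x ^ 2 + y ^ 2) := by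
      have h2 : |x * y| ≤ x ^ 2 + y ^ 2 := by
        rw [abs_le]; constructor <;> nlinarith [sq_nonneg (x + y), sq_nonneg (x - y)]
      calc a * (x * y) ≤ |a * (x * y)| := le_abs_self _
        _ = |a| * |x * y| := abs_mul _ _
        _ ≤ _ := by gcongr
    have q1 := p ς (f2 t) (f t)
    have q2 := p (-c) (f2 t) (f1 t)
    have q3 : -b * f2 t ^ 2 ≤ |b| * f2 t ^ 2 :=
      mul_le_mul_of_nonneg_right (neg_le_abs b) (sq_nonneg _)
    rw [abs_neg] at q2
    have q4 : (2 + |b| + |c| + |ς|) * Φ t ≤ N * Φ t :=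
      mul_le_mul_of_nonneg_right hN (by positivity)
    refine le_trans ?_ q4
    rw [h1]
    simp only [Φ]
    nlinarith [sq_nonneg (f t - f1 t), sq_nonneg (f1 t - f2 t), abs_nonneg b, abs_nonneg c,
      abs_nonneg ς, mul_nonneg (abs_nonneg b) (sq_nonneg (f t)),
      mul_nonneg (abs_nonneg b) (sq_nonneg (f1 t)), mul_nonneg (abs_nonneg c) (sq_nonneg (f t)),
      mul_nonneg (abs_nonneg ς) (sq_nonneg (f1 t)), sq_nonneg (f t), sq_nonneg (f2 t)]
  have hanti (ε : ℝ) (hε : 0 < ε) (hε1 : ε ≤ 1) : Φ 1 ≤ Φ ε / ε ^ N := by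
    have hder {t : ℝ} (ht : t ∈ Icc ε 1) := (hΦ (h01 ⟨hε.le.trans ht.1, ht.2⟩)).fun_div
      (hasDerivAt_pow N t) (pow_ne_zero N (hε.trans_le ht.1).ne')
    have h := antitoneOn_of_deriv_nonpos (f := fun t => Φ t / t ^ N) (convex_Icc ε 1)
      (fun t ht => (hder ht).continuousAt.continuousWithinAt)
      (fun t ht => (hder (interior_subset ht)).differentiableAt.differentiableWithinAt)
      (fun t ht => by
        have ht' := interior_subset ht
        have ht0 : 0 < t := hε.trans_le ht'.1
        rw [(hder ht').deriv]
        refine div_nonpos_of_nonpos_of_nonneg ?_ (sq_nonneg _)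
        have h2 : t * (Φ' t * t ^ N - Φ t * (N * t ^ (N - 1)))
            = t ^ N * (t * Φ' t - N * Φ t) := by
          cases N with
          | zero => simp
          | succ M => simp only [Nat.add_sub_cancel, pow_succ]; ring
        have h3 : t ^ N * (t * Φ' t - N * Φ t) ≤ 0 :=
          mul_nonpos_of_nonneg_of_nonpos (by positivity)
            (sub_nonpos.2 (hΦ' (h01 ⟨ht0.le, ht'.2⟩)))
        rw [← h2] at h3
        exact nonpos_of_mul_nonpos_right h3 ht0)
      (left_mem_Icc.2 hε1) (right_mem_Icc.2 hε1) hε1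
    simpa using h
  have hsmall (ε : ℝ) (hε : ε ∈ Ioo (0 : ℝ) 1) : Φ 1 ≤ (C0 ^ 2 + C1 ^ 2 + C2 ^ 2) * ε := by
    have hε' : ε ∈ Icc (0 : ℝ) 1 := Ioo_subset_Icc_self hε
    refine (hanti ε hε.1 hε.2.le).trans ?_
    rw [div_le_iff₀ (pow_pos hε.1 N), mul_assoc, ← pow_succ']
    have hsq {C y : ℝ} (hC : 0 ≤ C) (hy : |y| ≤ C * ε ^ (N + 1)) :
        y ^ 2 ≤ C ^ 2 * ε ^ (N + 1) := by
      have h1 : ε ^ (N + 1) ≤ 1 := pow_le_one₀ hε.1.le hε.2.le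
      have h2 : 0 < ε ^ (N + 1) := pow_pos hε.1 _
      calc y ^ 2 = |y| ^ 2 := (sq_abs y).symm
        _ ≤ (C * ε ^ (N + 1)) ^ 2 := by gcongr
        _ = C ^ 2 * (ε ^ (N + 1) * ε ^ (N + 1)) := by ring
        _ ≤ C ^ 2 * (ε ^ (N + 1) * 1) := by gcongr
        _ = _ := by ring
    have := hsq hC0 (hb0 ε hε')
    have := hsq hC1 (hb1 ε hε')
    have := hsq hC2 (hb2 ε hε')
    simp only [Φ]
    linarith
  have hΦ1 : Φ 1 ≤ 0 := by
    have hlim : Filter.Tendsto (fun ε : ℝ => (C0 ^ 2 + C1 ^ 2 + C2 ^ 2) * ε) (𝓝[>] 0) (𝓝 0) := by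
      have : ContinuousAt (fun ε : ℝ => (C0 ^ 2 + C1 ^ 2 + C2 ^ 2) * ε) 0 := by fun_prop
      simpa [ContinuousAt] using this.tendsto.mono_left nhdsWithin_le_nhds
    refine ge_of_tendsto hlim ?_
    filter_upwards [Ioo_mem_nhdsGT (zero_lt_one' ℝ)] with ε hε using hsmall ε hε
  simp only [Φ] at hΦ1
  have : f 1 ^ 2 = 0 := by nlinarith [sq_nonneg (f 1), sq_nonneg (f1 1), sq_nonneg (f2 1)]
  exact pow_eq_zero_iff (two_ne_zero) |>.1 this

theorem mul_iteratedDeriv_eq_zero_of_euler_equation {b c ς : ℝ} (hs : IsOpen s)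
    (h0 : (0 : ℝ) ∈ s) (hf : ContDiffOn ℝ ∞ f s)
    (heq : ∀ t ∈ s, 2 * euler (euler (euler f)) t + b * euler (euler f) t + c * euler f t
      = ς * f t) (j : ℕ) :
    (2 * (j : ℝ) ^ 3 + b * j ^ 2 + c * j - ς) * iteratedDeriv j f 0 = 0 := by
  have hs1 := contDiffOn_euler hs hf
  have hs2 := contDiffOn_euler hs hs1
  have hs3 := contDiffOn_euler hs hs2
  have hat {k : ℝ → ℝ} (hk : ContDiffOn ℝ ∞ k s) : ContDiffAt ℝ j k 0 :=
    (hk.contDiffAt_of_isOpen hs h0).of_le (by norm_cast; exact le_top)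
  have h1 : (fun t => 2 * euler (euler (euler f)) t + b * euler (euler f) t + c * euler f t)
      =ᶠ[𝓝 0] fun t => ς * f t := by
    filter_upwards [hs.mem_nhds h0] with t ht using heq t ht
  have h2 := h1.iteratedDeriv_eq j
  rw [iteratedDeriv_fun_add ((contDiffAt_const.mul (hat hs3)).add (contDiffAt_const.mul (hat hs2)))
    (contDiffAt_const.mul (hat hs1)), iteratedDeriv_fun_add (contDiffAt_const.mul (hat hs3))
    (contDiffAt_const.mul (hat hs2))] at h2
  simp only [iteratedDeriv_const_mul_field, iteratedDeriv_euler_zero hs h0 hs2,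
    iteratedDeriv_euler_zero hs h0 hs1, iteratedDeriv_euler_zero hs h0 hf] at h2
  linear_combination h2

theorem euler_sub_monomial {t : ℝ} (hf : DifferentiableAt ℝ f t) (C : ℝ) (k : ℕ) :
    euler (fun t => f t - C * t ^ k) t = euler f t - C * k * t ^ k := by
  rw [euler_real, euler_real, (hf.hasDerivAt.fun_sub ((hasDerivAt_pow k t).const_mul C)).deriv]
  cases k with
  | zero => simp
  | succ k => simp only [Nat.add_sub_cancel, pow_succ]; ring

/-- A solution of the Euler equation that is smooth at `0` is the monomial given by the only
exponent that solves the indicial equation. -/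
theorem eq_iteratedDeriv_of_euler_equation {b c ς : ℝ} (hs : IsOpen s) (h01 : Icc 0 1 ⊆ s)
    (hf : ContDiffOn ℝ ∞ f s)
    (heq : ∀ t ∈ s, 2 * euler (euler (euler f)) t + b * euler (euler f) t + c * euler f t
      = ς * f t) {k : ℕ}
    (hk : ∀ j : ℕ, 2 * (j : ℝ) ^ 3 + b * j ^ 2 + c * j = ς ↔ j = k) :
    f 1 = iteratedDeriv k f 0 / k.factorial := by
  have h0 : (0 : ℝ) ∈ s := h01 (left_mem_Icc.2 zero_le_one)
  set C := iteratedDeriv k f 0 / k.factorial with hC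
  have hp {C : ℝ} : ContDiff ℝ ∞ fun t : ℝ => C * t ^ k := by fun_prop
  have hg : ContDiffOn ℝ ∞ (fun t => f t - C * t ^ k) s := hf.sub hp.contDiffOn
  have hdiff {u : ℝ → ℝ} (hu : ContDiffOn ℝ ∞ u s) {t : ℝ} (ht : t ∈ s) :
      DifferentiableAt ℝ u t := (hu.contDiffAt_of_isOpen hs ht).differentiableAt (by simp)
  have hs1 := contDiffOn_euler hs hf
  have hs2 := contDiffOn_euler hs hs1
  have e1 (t) (ht : t ∈ s) : euler (fun t => f t - C * t ^ k) t = euler f t - C * k * t ^ k :=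
    euler_sub_monomial (hdiff hf ht) C k
  have e2 (t) (ht : t ∈ s) : euler (euler fun t => f t - C * t ^ k) t
      = euler (euler f) t - C * k * k * t ^ k := by
    rw [euler_congr_of_isOpen hs e1 ht, euler_sub_monomial (hdiff hs1 ht)]
  have e3 (t) (ht : t ∈ s) : euler (euler (euler fun t => f t - C * t ^ k)) t
      = euler (euler (euler f)) t - C * k * k * k * t ^ k := by
    rw [euler_congr_of_isOpen hs e2 ht, euler_sub_monomial (hdiff hs2 ht)]
  have hflat (j : ℕ) : iteratedDeriv j (fun t => f t - C * t ^ k) 0 = 0 := by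
    rw [iteratedDeriv_fun_sub ((hf.contDiffAt_of_isOpen hs h0).of_le (by norm_cast; exact le_top))
      (hp.contDiffAt.of_le (by norm_cast; exact le_top)), iteratedDeriv_const_mul_field,
      iteratedDeriv_fun_pow_zero]
    by_cases hjk : j = k
    · subst hjk
      have := Nat.factorial_ne_zero j
      simp only [hC, if_true]
      field_simp
      simp
    · have h := mul_iteratedDeriv_eq_zero_of_euler_equation hs h0 hf heq j
      rcases mul_eq_zero.1 h with h | h
      · exact absurd ((hk j).1 (sub_eq_zero.1 h)) hjk
      · simp [h, hjk]
  have hfin := eq_zero_of_euler_equation (b := b) (c := c) (ς := ς) hs h01 hg hflat fun t ht => by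
    rw [e1 t ht, e2 t ht, e3 t ht]
    have h1 := heq t ht
    have h2 := (hk k).2 rfl
    linear_combination h1 - C * t ^ k * h2
  simpa [sub_eq_zero] using hfin

theorem eq_zero_of_euler_equation_of_forall_ne {b c ς : ℝ} (hs : IsOpen s) (h01 : Icc 0 1 ⊆ s)
    (hf : ContDiffOn ℝ ∞ f s)
    (heq : ∀ t ∈ s, 2 * euler (euler (euler f)) t + b * euler (euler f) t + c * euler f t
      = ς * f t) (hk : ∀ j : ℕ, 2 * (j : ℝ) ^ 3 + b * j ^ 2 + c * j ≠ ς) : f 1 = 0 :=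
  eq_zero_of_euler_equation hs h01 hf (fun j => (mul_eq_zero.1
    (mul_iteratedDeriv_eq_zero_of_euler_equation hs (h01 (left_mem_Icc.2 zero_le_one)) hf heq
      j)).resolve_left (sub_ne_zero.2 (hk j))) heq

end EulerODE

section Rays

open Set

variable {E : Type*} [NormedAddCommGroup E] [InnerProductSpace ℝ E] {f : E → ℝ} {x : E}

theorem isOpen_ray_preimage (x : E) : IsOpen {t : ℝ | t • x ∈ ball (0 : E) 1} :=
  isOpen_ball.preimage (by fun_prop)

theorem Icc_subset_ray_preimage (hx : x ∈ ball (0 : E) 1) :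
    Icc 0 1 ⊆ {t : ℝ | t • x ∈ ball (0 : E) 1} := by
  intro t ht
  rw [mem_ball_zero_iff] at hx
  simp only [mem_ball_zero_iff, norm_smul, Real.norm_of_nonneg ht.1, mem_ofPred_eq]
  exact (mul_le_of_le_one_left (norm_nonneg x) ht.2).trans_lt hx

theorem contDiffOn_comp_ray (hf : ContDiffOn ℝ ∞ f (ball 0 1)) (x : E) :
    ContDiffOn ℝ ∞ (fun t : ℝ => f (t • x)) {t : ℝ | t • x ∈ ball (0 : E) 1} :=
  hf.comp (by fun_prop) fun _ ht => ht

theorem euler_comp_ray {t : ℝ} (hf : DifferentiableAt ℝ f (t • x)) :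
    euler (fun t : ℝ => f (t • x)) t = euler f (t • x) := by
  have h : HasDerivAt (fun t : ℝ => t • x) x t := by
    simpa using (hasDerivAt_id t).smul_const x
  have h1 : deriv (fun t : ℝ => f (t • x)) t = _ := (hf.hasFDerivAt.comp_hasDerivAt t h).deriv
  rw [euler_real, h1, euler, map_smul, smul_eq_mul]

/-- The derivatives at `0` along a ray, as values of the iterated derivatives of the function. -/
theorem iteratedDeriv_comp_ray_zero (hf : ContDiffOn ℝ ∞ f (ball 0 1)) (x : E) (k : ℕ) :
    iteratedDeriv k (fun t : ℝ => f (t • x)) 0 = iteratedFDeriv ℝ k f 0 fun _ => x := by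
  let L : ℝ →L[ℝ] E := ContinuousLinearMap.toSpanSingleton ℝ x
  have hL : ∀ t, L t = t • x := fun t => by simp [L]
  have hopen : IsOpen (L ⁻¹' ball 0 1) := isOpen_ball.preimage L.continuous
  have h0 : L 0 ∈ ball (0 : E) 1 := by simp
  have h := L.iteratedFDerivWithin_comp_right hf isOpen_ball.uniqueDiffOn hopen.uniqueDiffOn h0
    (i := k) (by norm_cast; exact le_top)
  rw [iteratedFDerivWithin_of_isOpen k hopen h0,
    iteratedFDerivWithin_of_isOpen k isOpen_ball h0] at h
  have hfun : (fun t : ℝ => f (t • x)) = f ∘ L := funext fun t => by simp [hL]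
  rw [iteratedDeriv_eq_iteratedFDeriv, hfun, h]
  simp [hL]

end Rays

/-! ### The Almansi decomposition and the boundary conditions -/

section BoundaryValues

open Set

variable {n : ℕ} {u : EuclideanSpace ℝ (Fin n) → ℝ}

theorem continuousOn_normalDeriv (hu : ContDiffOn ℝ 1 u (unitBall n)) :
    ContinuousOn (normalDeriv u) (unitBall n) :=
  (hu.continuousOn_fderivWithin (uniqueDiffOn_unitBall n) le_rfl).clm_apply continuousOn_id

theorem contDiffOn_one_laplacianWithin (hu : ContDiffOn ℝ 3 u (unitBall n)) :
    ContDiffOn ℝ 1 (Δ[unitBall n] u) (unitBall n) := by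
  exact_mod_cast contDiffOn_laplacian (m := 1) (k := 3) (by exact_mod_cast hu)
    (uniqueDiffOn_unitBall n) (by norm_num)

theorem continuousOn_fderivWithin_fderivWithin_self (hu : ContDiffOn ℝ 2 u (unitBall n)) :
    ContinuousOn (fun x => fderivWithin ℝ (fderivWithin ℝ u (unitBall n)) (unitBall n) x x x)
      (unitBall n) :=
  (((hu.fderivWithin (m := 1) (uniqueDiffOn_unitBall n) (by norm_num)).continuousOn_fderivWithin
    (uniqueDiffOn_unitBall n) le_rfl).clm_apply continuousOn_id).clm_apply continuousOn_id

theorem normalDeriv_eq_euler {x : EuclideanSpace ℝ (Fin n)} (hx : x ∈ ball 0 1) :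
    normalDeriv u x = euler u x := by
  rw [normalDeriv, fderivWithin_eq_fderiv_of_mem_ball u hx, euler]

theorem normalDeriv_laplacianWithin_eq_euler {x : EuclideanSpace ℝ (Fin n)} (hx : x ∈ ball 0 1) :
    normalDeriv (Δ[unitBall n] u) x = euler (Δ u) x := by
  rw [normalDeriv_eq_euler hx, euler_congr_of_isOpen isOpen_ball
    (fun y hy => laplacianWithin_eq_laplacian_of_mem_ball u hy) hx]

theorem fderivWithin_fderivWithin_eq_fderiv {x : EuclideanSpace ℝ (Fin n)} (hx : x ∈ ball 0 1) :
    fderivWithin ℝ (fderivWithin ℝ u (unitBall n)) (unitBall n) x = fderiv ℝ (fderiv ℝ u) x := by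
  rw [fderivWithin_eq_fderiv_of_mem_ball _ hx]
  refine Filter.EventuallyEq.fderiv_eq ?_
  filter_upwards [isOpen_ball.mem_nhds hx] with y hy using fderivWithin_eq_fderiv_of_mem_ball u hy

end BoundaryValues

section Almansi

variable {n : ℕ} {u : EuclideanSpace ℝ (Fin n) → ℝ}

/-- **Almansi decomposition** of a biharmonic function on the unit ball. The second component is
normalized by `4 x · ∇ h₂ + 2 n h₂ = Δ u`, and it is bounded when `Δ u` is. -/
theorem exists_almansi (hn : 1 ≤ n) (hu : ContDiffOn ℝ 4 u (ball 0 1))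
    (hΔ : ∀ x ∈ ball (0 : EuclideanSpace ℝ (Fin n)) 1, Δ (Δ u) x = 0) :
    ∃ h h₂ : EuclideanSpace ℝ (Fin n) → ℝ, ContDiffOn ℝ ∞ h (ball 0 1) ∧
      ContDiffOn ℝ ∞ h₂ (ball 0 1) ∧ (∀ x ∈ ball 0 1, Δ h x = 0) ∧ (∀ x ∈ ball 0 1, Δ h₂ x = 0) ∧
      (∀ x ∈ ball 0 1, u x = h x + (‖x‖ ^ 2 - 1) * h₂ x) ∧
      (∀ x ∈ ball 0 1, Δ u x = 4 * euler h₂ x + 2 * n * h₂ x) ∧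
      ∀ C, (∀ x ∈ ball 0 1, |Δ u x| ≤ C) → ∀ x ∈ ball 0 1, |h₂ x| ≤ C := by
  have hv : ContDiffOn ℝ ∞ (Δ u) (ball 0 1) :=
    contDiffOn_of_laplacian_eq_zero isOpen_ball
      (fun x hx => (contDiffAt_laplacian hu hx).contDiffWithinAt) hΔ
  have hw : Continuous fun s : ℝ => s ^ (n - 1) / 2 := by fun_prop
  set h₂ := dilationAverage (fun s => s ^ (n - 1) / 2) (Δ u)
  have hh₂ : ContDiffOn ℝ ∞ h₂ (ball 0 1) := contDiffOn_dilationAverage hw hv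
  have hΔ₂ (x) (hx : x ∈ ball 0 1) : Δ h₂ x = 0 := laplacian_dilationAverage_eq_zero hw hv hΔ hx
  have heu (x) (hx : x ∈ ball 0 1) : 4 * euler h₂ x + 2 * n * h₂ x = Δ u x :=
    euler_dilationAverage hn hv hx
  let h : EuclideanSpace ℝ (Fin n) → ℝ := fun x => u x - (‖x‖ ^ 2 - 1) * h₂ x
  have hprod : ContDiffOn ℝ ∞ (fun x => (‖x‖ ^ 2 - 1) * h₂ x) (ball 0 1) :=
    contDiff_normSq_sub_one.contDiffOn.mul hh₂
  have hh : ContDiffOn ℝ 2 h (ball 0 1) :=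
    (hu.of_le (by norm_num)).sub (hprod.of_le (by norm_cast))
  have hΔh (x) (hx : x ∈ ball 0 1) : Δ h x = 0 := by
    have h1 : Δ h x = Δ u x - Δ (fun x => (‖x‖ ^ 2 - 1) * h₂ x : EuclideanSpace ℝ (Fin n) → ℝ) x :=
      ((hu.contDiffAt_of_isOpen isOpen_ball hx).of_le (by norm_num)).laplacian_sub
        ((hprod.contDiffAt_of_isOpen isOpen_ball hx).of_le (by norm_cast))
    rw [h1, laplacian_normSq_sub_one_mul
      ((hh₂.contDiffAt_of_isOpen isOpen_ball hx).of_le (by norm_cast)), hΔ₂ x hx, ← heu x hx,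
      finrank_euclideanSpace, Fintype.card_fin]
    ring
  exact ⟨h, h₂, contDiffOn_of_laplacian_eq_zero isOpen_ball hh hΔh, hh₂, hΔh, hΔ₂,
    fun x _ => by simp [h], fun x hx => (heu x hx).symm,
    fun C hC x hx => abs_dilationAverage_le hC hx⟩

theorem laplacian_euler_eq_zero {h : EuclideanSpace ℝ (Fin n) → ℝ}
    (hh : ContDiffOn ℝ ∞ h (ball 0 1)) (hΔ : ∀ x ∈ ball 0 1, Δ h x = 0)
    (x : EuclideanSpace ℝ (Fin n)) (hx : x ∈ ball 0 1) : Δ (euler h) x = 0 := by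
  have h1 : euler (Δ h) x = euler (fun _ => (0 : ℝ)) x :=
    euler_congr_of_isOpen isOpen_ball hΔ hx
  rw [laplacian_euler isOpen_ball hh hx, h1, hΔ x hx]
  simp [euler]

theorem laplacian_add_eq_zero {f g : EuclideanSpace ℝ (Fin n) → ℝ}
    (hf : ContDiffOn ℝ ∞ f (ball 0 1)) (hg : ContDiffOn ℝ ∞ g (ball 0 1))
    (hΔf : ∀ x ∈ ball 0 1, Δ f x = 0) (hΔg : ∀ x ∈ ball 0 1, Δ g x = 0)
    (x : EuclideanSpace ℝ (Fin n)) (hx : x ∈ ball 0 1) : Δ (fun y => f y + g y) x = 0 := by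
  have h : Δ (fun y => f y + g y) x = Δ f x + Δ g x :=
    ((hf.contDiffAt_of_isOpen isOpen_ball hx).of_le (by norm_cast)).laplacian_add
      ((hg.contDiffAt_of_isOpen isOpen_ball hx).of_le (by norm_cast))
  rw [h, hΔf x hx, hΔg x hx, add_zero]

theorem laplacian_const_mul_eq_zero {f : EuclideanSpace ℝ (Fin n) → ℝ}
    (hf : ContDiffOn ℝ ∞ f (ball 0 1)) (hΔf : ∀ x ∈ ball 0 1, Δ f x = 0) (c : ℝ)
    (x : EuclideanSpace ℝ (Fin n)) (hx : x ∈ ball 0 1) : Δ (fun y => c * f y) x = 0 := by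
  have h : Δ (fun y => c * f y) x = c • Δ f x :=
    laplacian_smul c ((hf.contDiffAt_of_isOpen isOpen_ball hx).of_le (by norm_cast))
  rw [h, hΔf x hx, smul_zero]

end Almansi

section Solution

open Set

variable {n : ℕ} {β ς : ℝ} {u : EuclideanSpace ℝ (Fin n) → ℝ}

/-- A solution of the Wentzell problem is determined by the harmonic function `h` with the same
boundary values: the Neumann condition says that the second Almansi component of `u` is
`-½ x · ∇ h`, and the Wentzell condition becomes an equation with constant coefficients in the
Euler operator. The two boundary conditions are transferred to the interior by the maximum
principle, as each says that a harmonic function tends to `0` at the sphere. -/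
theorem IsSolution.exists_harmonic (hn : 1 ≤ n) (hu : IsSolution n β ς u) :
    ∃ h : EuclideanSpace ℝ (Fin n) → ℝ, ContDiffOn ℝ ∞ h (ball 0 1) ∧
      (∀ x ∈ ball 0 1, Δ h x = 0) ∧
      (∀ x ∈ ball 0 1, u x = h x - (‖x‖ ^ 2 - 1) / 2 * euler h x) ∧
      ∀ x ∈ ball 0 1, 2 * euler (euler (euler h)) x + (n + β) * euler (euler h) x
        + β * (n - 2) * euler h x = ς * h x := by
  have : Nonempty (Fin n) := ⟨⟨0, hn⟩⟩
  obtain ⟨h, k, hh, hk, hΔh, hΔk, hdec, hΔu, hbd⟩ :=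
    exists_almansi hn hu.contDiffOn_interior hu.biharmonic
  have hV := contDiffOn_one_laplacianWithin hu.contDiffOn
  have hu2 : ContDiffOn ℝ 2 u (unitBall n) := hu.contDiffOn.of_le (by norm_num)
  have hNu := continuousOn_normalDeriv (hu.contDiffOn.of_le (by norm_num) : ContDiffOn ℝ 1 u _)
  have hNV := continuousOn_normalDeriv hV
  have hcpt : IsCompact (unitBall n) := isCompact_closedBall 0 1
  have hsub : ball (0 : EuclideanSpace ℝ (Fin n)) 1 ⊆ unitBall n := ball_subset_closedBall
  have hdiff {f : EuclideanSpace ℝ (Fin n) → ℝ} (hf : ContDiffOn ℝ ∞ f (ball 0 1)) {x}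
      (hx : x ∈ ball (0 : EuclideanSpace ℝ (Fin n)) 1) : DifferentiableAt ℝ f x :=
    (hf.contDiffAt_of_isOpen isOpen_ball hx).differentiableAt (by simp)
  have hEh := contDiffOn_euler isOpen_ball hh
  have hEEh := contDiffOn_euler isOpen_ball hEh
  have hEEEh := contDiffOn_euler isOpen_ball hEEh
  have hEk := contDiffOn_euler isOpen_ball hk
  -- `Δ u`, `x · ∇ Δ u`, and hence `k`, `x · ∇ k` and `(x · ∇)² k` are bounded
  obtain ⟨C₀, hC₀⟩ := hcpt.exists_bound_of_continuousOn hV.continuousOn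
  obtain ⟨C₁, hC₁⟩ := hcpt.exists_bound_of_continuousOn hNV
  have hv (x) (hx : x ∈ ball (0 : EuclideanSpace ℝ (Fin n)) 1) : |Δ u x| ≤ C₀ := by
    rw [← laplacianWithin_eq_laplacian_of_mem_ball u hx]
    exact hC₀ x (hsub hx)
  have hEv (x) (hx : x ∈ ball (0 : EuclideanSpace ℝ (Fin n)) 1) : |euler (Δ u) x| ≤ C₁ := by
    rw [← normalDeriv_laplacianWithin_eq_euler hx]
    exact hC₁ x (hsub hx)
  have hEΔu (x) (hx : x ∈ ball (0 : EuclideanSpace ℝ (Fin n)) 1) :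
      euler (Δ u) x = 4 * euler (euler k) x + 2 * n * euler k x := by
    rw [euler_congr_of_isOpen isOpen_ball hΔu hx,
      euler_add ((hdiff hEk hx).const_mul 4) ((hdiff hk hx).const_mul _),
      euler_const_mul (hdiff hEk hx), euler_const_mul (hdiff hk hx)]
  have hn0 : (0 : ℝ) ≤ n := n.cast_nonneg
  have hbk := hbd C₀ hv
  obtain ⟨K₁, hbEk⟩ : ∃ K, ∀ x ∈ ball (0 : EuclideanSpace ℝ (Fin n)) 1, |euler k x| ≤ K := by
    refine ⟨(C₀ + 2 * n * C₀) / 4, fun x hx => ?_⟩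
    have e : euler k x = (Δ u x - 2 * n * k x) / 4 := by rw [hΔu x hx]; ring
    have h1 := abs_le.1 (hv x hx)
    have h2 := abs_le.1 (hbk x hx)
    rw [e, abs_le]
    constructor <;> nlinarith
  obtain ⟨K₂, hbEEk⟩ :
      ∃ K, ∀ x ∈ ball (0 : EuclideanSpace ℝ (Fin n)) 1, |euler (euler k) x| ≤ K := by
    refine ⟨(C₁ + 2 * n * K₁) / 4, fun x hx => ?_⟩
    have e : euler (euler k) x = (euler (Δ u) x - 2 * n * euler k x) / 4 := by
      rw [hEΔu x hx]; ring
    have h1 := abs_le.1 (hEv x hx)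
    have h2 := abs_le.1 (hbEk x hx)
    rw [e, abs_le]
    constructor <;> nlinarith
  have hr (x) (hx : x ∈ ball (0 : EuclideanSpace ℝ (Fin n)) 1) : 0 ≤ 1 - ‖x‖ ^ 2 := by
    have := (mem_ball_zero_iff.1 hx).le
    exact sub_nonneg.2 (pow_le_one₀ (norm_nonneg x) this)
  have hcontr {K : ℝ} : ContinuousOn (fun x : EuclideanSpace ℝ (Fin n) => (1 - ‖x‖ ^ 2) * K)
      (unitBall n) := by fun_prop
  have hEu (x) (hx : x ∈ ball (0 : EuclideanSpace ℝ (Fin n)) 1) :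
      euler u x = euler h x + (2 * ‖x‖ ^ 2 * k x + (‖x‖ ^ 2 - 1) * euler k x) := by
    rw [euler_congr_of_isOpen isOpen_ball hdec hx, euler_add (hdiff hh hx)
      (hdiff (contDiff_normSq_sub_one.contDiffOn.mul hk) hx),
      euler_normSq_sub_one_mul (hdiff hk hx)]
  -- the Neumann condition
  have hneu (x) (hx : x ∈ ball (0 : EuclideanSpace ℝ (Fin n)) 1) : euler h x = -2 * k x := by
    have h0 := eq_zero_of_laplacian_eq_zero (H := fun x => euler h x + 2 * k x)
      (G := fun x => |normalDeriv u x| + (1 - ‖x‖ ^ 2) * (K₁ + 2 * C₀))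
      ((hEh.add (contDiffOn_const.mul hk)).of_le (by norm_cast))
      (laplacian_add_eq_zero hEh (contDiffOn_const.mul hk) (laplacian_euler_eq_zero hh hΔh)
        (laplacian_const_mul_eq_zero hk hΔk 2)) (hNu.abs.add hcontr)
      (fun y hy => by
        rw [hu.neumann y hy, mem_sphere_zero_iff_norm.1 hy]
        simp)
      (fun y hy => by
        have e : euler h y + 2 * k y
            = normalDeriv u y + (1 - ‖y‖ ^ 2) * (euler k y + 2 * k y) := by
          rw [normalDeriv_eq_euler hy, hEu y hy]; ring
        have h1 := abs_le.1 (hbEk y hy)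
        have h2 := abs_le.1 (hbk y hy)
        have h3 : |euler k y + 2 * k y| ≤ K₁ + 2 * C₀ := by
          rw [abs_le]; constructor <;> linarith
        rw [e]
        refine (abs_add_le _ _).trans ?_
        rw [abs_mul, abs_of_nonneg (hr y hy)]
        gcongr
        exact hr y hy) hx
    linarith
  have hneu2 (x) (hx : x ∈ ball (0 : EuclideanSpace ℝ (Fin n)) 1) :
      euler (euler h) x = -2 * euler k x := by
    rw [euler_congr_of_isOpen isOpen_ball hneu hx, euler_const_mul (hdiff hk hx)]
  have hneu3 (x) (hx : x ∈ ball (0 : EuclideanSpace ℝ (Fin n)) 1) :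
      euler (euler (euler h)) x = -2 * euler (euler k) x := by
    rw [euler_congr_of_isOpen isOpen_ball hneu2 hx, euler_const_mul (hdiff hEk hx)]
  have hEu' (x) (hx : x ∈ ball (0 : EuclideanSpace ℝ (Fin n)) 1) :
      euler u x = (‖x‖ ^ 2 - 1) * (2 * k x + euler k x) := by
    rw [hEu x hx, hneu x hx]; ring
  have hEEu (x) (hx : x ∈ ball (0 : EuclideanSpace ℝ (Fin n)) 1) :
      euler (euler u) x = 2 * ‖x‖ ^ 2 * (2 * k x + euler k x)
        + (‖x‖ ^ 2 - 1) * (2 * euler k x + euler (euler k) x) := by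
    rw [euler_congr_of_isOpen isOpen_ball hEu' hx,
      euler_normSq_sub_one_mul (((hdiff hk hx).const_mul 2).fun_add (hdiff hEk hx)),
      euler_add ((hdiff hk hx).const_mul 2) (hdiff hEk hx), euler_const_mul (hdiff hk hx)]
  refine ⟨h, hh, hΔh, fun x hx => by rw [hdec x hx, hneu x hx]; ring, fun x hx => ?_⟩
  -- the Wentzell condition; `F` is its left hand side, continued to the whole ball
  let F : EuclideanSpace ℝ (Fin n) → ℝ := fun x => normalDeriv (Δ[unitBall n] u) x
    + β * ((Δ[unitBall n] u) x
      - fderivWithin ℝ (fderivWithin ℝ u (unitBall n)) (unitBall n) x x x) + ς * u x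
  have hF : ContinuousOn F (unitBall n) :=
    (hNV.add (continuousOn_const.mul (hV.continuousOn.sub
      (continuousOn_fderivWithin_fderivWithin_self hu2)))).add
      (continuousOn_const.mul hu2.continuousOn)
  have hF0 (y) (hy : y ∈ unitSphere n) : F y = 0 := by
    have h1 := hu.wentzell y hy
    rw [sphereLaplacian_eq hu2 hy] at h1
    have h2 : fderivWithin ℝ u (unitBall n) y y = 0 := hu.neumann y hy
    rw [h2] at h1
    simp only [F]
    linarith
  have hFball (y) (hy : y ∈ ball (0 : EuclideanSpace ℝ (Fin n)) 1) :
      F y = euler (Δ u) y + β * (Δ u y - (euler (euler u) y - euler u y)) + ς * u y := by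
    simp only [F]
    rw [normalDeriv_laplacianWithin_eq_euler hy, laplacianWithin_eq_laplacian_of_mem_ball u hy,
      fderivWithin_fderivWithin_eq_fderiv hy, fderiv_fderiv_apply_self
        ((hu.contDiffOn_interior.contDiffAt_of_isOpen isOpen_ball hy).of_le (by norm_num))]
  have hΔ1 := laplacian_euler_eq_zero hh hΔh
  have hΔ2 := laplacian_euler_eq_zero hEh hΔ1
  have hΔ3 := laplacian_euler_eq_zero hEEh hΔ2
  have hc {f : EuclideanSpace ℝ (Fin n) → ℝ} (hf : ContDiffOn ℝ ∞ f (ball 0 1)) (c : ℝ) :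
      ContDiffOn ℝ ∞ (fun x => c * f x) (ball 0 1) := contDiffOn_const.mul hf
  let H : EuclideanSpace ℝ (Fin n) → ℝ := fun x => 2 * euler (euler (euler h)) x
    + (n + β) * euler (euler h) x + β * (n - 2) * euler h x + (-ς) * h x
  have hH : ContDiffOn ℝ ∞ H (ball 0 1) :=
    (((hc hEEEh 2).add (hc hEEh _)).add (hc hEh _)).add (hc hh _)
  have hΔH : ∀ x ∈ ball (0 : EuclideanSpace ℝ (Fin n)) 1, Δ H x = 0 :=
    laplacian_add_eq_zero (((hc hEEEh 2).add (hc hEEh _)).add (hc hEh _)) (hc hh _)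
      (laplacian_add_eq_zero ((hc hEEEh 2).add (hc hEEh _)) (hc hEh _)
        (laplacian_add_eq_zero (hc hEEEh 2) (hc hEEh _)
          (laplacian_const_mul_eq_zero hEEEh hΔ3 _) (laplacian_const_mul_eq_zero hEEh hΔ2 _))
        (laplacian_const_mul_eq_zero hEh hΔ1 _)) (laplacian_const_mul_eq_zero hh hΔh _)
  have h0 := eq_zero_of_laplacian_eq_zero (H := H)
    (G := fun x => |F x| + (1 - ‖x‖ ^ 2) * (|β| * (3 * K₁ + 2 * C₀ + K₂) + |ς| * C₀))
    (hH.of_le (by norm_cast)) hΔH (hF.abs.add hcontr)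
    (fun y hy => by rw [hF0 y hy, mem_sphere_zero_iff_norm.1 hy]; simp)
    (fun y hy => by
      have e : H y = -F y + (1 - ‖y‖ ^ 2) *
          (β * (3 * euler k y + 2 * k y + euler (euler k) y) + (-ς) * k y) := by
        rw [hFball y hy, hEΔu y hy, hΔu y hy, hEEu y hy, hEu' y hy, hdec y hy]
        simp only [H]
        rw [hneu3 y hy, hneu2 y hy, hneu y hy]
        ring
      have h1 := abs_le.1 (hbEk y hy)
      have h2 := abs_le.1 (hbk y hy)
      have h3 := abs_le.1 (hbEEk y hy)
      have h4 : |3 * euler k y + 2 * k y + euler (euler k) y| ≤ 3 * K₁ + 2 * C₀ + K₂ := by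
        rw [abs_le]; constructor <;> linarith
      rw [e]
      refine (abs_add_le _ _).trans ?_
      rw [abs_neg, abs_mul (1 - ‖y‖ ^ 2), abs_of_nonneg (hr y hy)]
      refine add_le_add le_rfl (mul_le_mul_of_nonneg_left ?_ (hr y hy))
      refine (abs_add_le _ _).trans ?_
      rw [abs_mul, abs_mul, abs_neg]
      gcongr
      exact hbk y hy) hx
  simp only [H] at h0
  linarith

end Solution

/-! ### Harmonic polynomials and their eigenfunctions -/

section Polynomials

open Set

variable {n : ℕ} {w : MvPolynomial (Fin n) ℝ} {x : EuclideanSpace ℝ (Fin n)}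

/-- The function on Euclidean space that is defined by a polynomial in the coordinates. -/
noncomputable def polyFun (w : MvPolynomial (Fin n) ℝ) (x : EuclideanSpace ℝ (Fin n)) : ℝ :=
  MvPolynomial.eval (fun i => x i) w

theorem hasFDerivAt_polyFun (w : MvPolynomial (Fin n) ℝ) (x : EuclideanSpace ℝ (Fin n)) :
    HasFDerivAt (polyFun w) (∑ i, polyFun (MvPolynomial.pderiv i w) x •
      (EuclideanSpace.proj i : EuclideanSpace ℝ (Fin n) →L[ℝ] ℝ)) x := by
  induction w using MvPolynomial.induction_on with
  | C a =>
    have h : polyFun (n := n) (MvPolynomial.C a) = fun _ => a := funext fun x => by simp [polyFun]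
    rw [h]
    exact (hasFDerivAt_const a x).congr_fderiv (by simp [polyFun])
  | add p q hp hq =>
    have h : polyFun (p + q) = fun x => polyFun p x + polyFun q x := funext fun x => by
      simp [polyFun]
    rw [h]
    refine (hp.fun_add hq).congr_fderiv ?_
    simp [polyFun, add_smul, Finset.sum_add_distrib]
  | mul_X p j hp =>
    have h : polyFun (p * MvPolynomial.X j) = fun x => polyFun p x * x j := funext fun x => by
      simp [polyFun]
    rw [h]
    have hX : HasFDerivAt (fun x : EuclideanSpace ℝ (Fin n) => x j)
        (EuclideanSpace.proj j : EuclideanSpace ℝ (Fin n) →L[ℝ] ℝ) x :=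
      (EuclideanSpace.proj j : EuclideanSpace ℝ (Fin n) →L[ℝ] ℝ).hasFDerivAt
    refine (hp.fun_mul hX).congr_fderiv ?_
    ext v
    simp [polyFun, MvPolynomial.pderiv_X, Pi.single_apply, Finset.sum_add_distrib, add_mul,
      Finset.mul_sum, apply_ite]
    ring_nf

theorem fderiv_polyFun_apply (w : MvPolynomial (Fin n) ℝ) (x v : EuclideanSpace ℝ (Fin n)) :
    fderiv ℝ (polyFun w) x v = ∑ i, polyFun (MvPolynomial.pderiv i w) x * v i := by
  simp [(hasFDerivAt_polyFun w x).fderiv]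

theorem contDiff_polyFun (w : MvPolynomial (Fin n) ℝ) : ContDiff ℝ ∞ (polyFun w) := by
  induction w using MvPolynomial.induction_on with
  | C a =>
    have h : polyFun (n := n) (MvPolynomial.C a) = fun _ => a := funext fun x => by simp [polyFun]
    rw [h]
    exact contDiff_const
  | add p q hp hq =>
    have h : polyFun (p + q) = fun x => polyFun p x + polyFun q x := funext fun x => by
      simp [polyFun]
    rw [h]
    exact hp.add hq
  | mul_X p j hp =>
    have h : polyFun (p * MvPolynomial.X j) = fun x => polyFun p x * x j := funext fun x => by
      simp [polyFun]
    rw [h]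
    exact hp.mul (EuclideanSpace.proj j : EuclideanSpace ℝ (Fin n) →L[ℝ] ℝ).contDiff

theorem laplacian_polyFun (w : MvPolynomial (Fin n) ℝ) (x : EuclideanSpace ℝ (Fin n)) :
    Δ (polyFun w) x
      = polyFun (∑ i, MvPolynomial.pderiv i (MvPolynomial.pderiv i w)) x := by
  rw [laplacian_eq_sum_fderiv (EuclideanSpace.basisFun (Fin n) ℝ)
    ((contDiff_polyFun w).contDiffAt.of_le (by norm_cast))]
  have h (p : MvPolynomial (Fin n) ℝ) (i : Fin n) :
      (fun y => fderiv ℝ (polyFun p) y (EuclideanSpace.basisFun (Fin n) ℝ i))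
        = polyFun (MvPolynomial.pderiv i p) := funext fun y => by
    simp [fderiv_polyFun_apply]
  simp only [h]
  rw [Finset.sum_congr rfl fun i _ => congrFun (h (MvPolynomial.pderiv i w) i) x]
  simp [polyFun]

theorem euler_polyFun {k : ℕ} (hw : w.IsHomogeneous k) (x : EuclideanSpace ℝ (Fin n)) :
    euler (polyFun w) x = k * polyFun w x := by
  have h := congrArg (fun p => polyFun p x) hw.sum_X_mul_pderiv
  simp only [polyFun, map_sum, map_mul, MvPolynomial.eval_X, nsmul_eq_mul, map_natCast] at h
  rw [euler, fderiv_polyFun_apply, polyFun, ← h]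
  exact Finset.sum_congr rfl fun i _ => mul_comm _ _

theorem eq_zero_of_polyFun_eq_zero (h : ∀ x ∈ ball 0 1, polyFun w x = 0) : w = 0 := by
  have hcont : Continuous fun y : Fin n → ℝ => WithLp.toLp 2 y := PiLp.continuous_toLp 2 _
  obtain ⟨ε, hε, hsub⟩ := Metric.isOpen_iff.1
    ((isOpen_ball (x := (0 : EuclideanSpace ℝ (Fin n))) (ε := 1)).preimage hcont) 0 (by simp)
  refine MvPolynomial.funext_set (fun _ => ball (0 : ℝ) ε) (fun _ => ?_) fun y hy => ?_
  · rw [Real.ball_eq_Ioo]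
    exact Set.Ioo_infinite (by linarith)
  · rw [map_zero]
    refine h (WithLp.toLp 2 y) (hsub ?_)
    rw [ball_pi _ hε]
    exact hy

theorem mem_harmonicPoly_iff {k : ℕ} :
    w ∈ harmonicPoly n k ↔ w.IsHomogeneous k ∧
      ∑ i, MvPolynomial.pderiv i (MvPolynomial.pderiv i w) = 0 := by
  simp [harmonicPoly, MvPolynomial.mem_homogeneousSubmodule]

theorem laplacian_polyFun_eq_zero {k : ℕ} (hw : w ∈ harmonicPoly n k)
    (x : EuclideanSpace ℝ (Fin n)) : Δ (polyFun w) x = 0 := by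
  rw [laplacian_polyFun, (mem_harmonicPoly_iff.1 hw).2]
  simp [polyFun]

/-- A polynomial that is homogeneous and harmonic on the unit ball is a harmonic polynomial. -/
theorem mem_harmonicPoly_of_laplacian_eq_zero {k : ℕ} (hw : w.IsHomogeneous k)
    (hΔ : ∀ x ∈ ball 0 1, Δ (polyFun w) x = 0) : w ∈ harmonicPoly n k :=
  mem_harmonicPoly_iff.2 ⟨hw, eq_zero_of_polyFun_eq_zero fun x hx => by
    rw [← laplacian_polyFun, hΔ x hx]⟩

/-- The homogeneous polynomial `x ↦ M(x, …, x)` of a multilinear form. -/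
theorem exists_polyFun_eq_multilinear {k : ℕ}
    (M : ContinuousMultilinearMap ℝ (fun _ : Fin k => EuclideanSpace ℝ (Fin n)) ℝ) :
    ∃ w : MvPolynomial (Fin n) ℝ, w.IsHomogeneous k ∧ ∀ x, polyFun w x = M fun _ => x := by
  refine ⟨∑ r : Fin k → Fin n, MvPolynomial.C (M fun j => EuclideanSpace.basisFun (Fin n) ℝ (r j)) *
    ∏ j, MvPolynomial.X (r j), ?_, fun x => ?_⟩
  · refine MvPolynomial.IsHomogeneous.sum _ _ _ fun r _ => ?_
    have h1 := MvPolynomial.IsHomogeneous.prod Finset.univ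
      (fun j => (MvPolynomial.X (r j) : MvPolynomial (Fin n) ℝ)) (fun _ => 1)
      fun j _ => MvPolynomial.isHomogeneous_X ℝ (r j)
    have h2 := (MvPolynomial.isHomogeneous_C (Fin n)
      (M fun j => EuclideanSpace.basisFun (Fin n) ℝ (r j))).mul h1
    simpa using h2
  · have hx : x = ∑ i, x i • EuclideanSpace.basisFun (Fin n) ℝ i := by
      conv_lhs => rw [← (EuclideanSpace.basisFun (Fin n) ℝ).sum_repr x]
      simp
    have h1 : (M fun _ => x) = M fun _ => ∑ i, x i • EuclideanSpace.basisFun (Fin n) ℝ i := by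
      rw [← hx]
    rw [h1, M.map_sum]
    simp only [polyFun, map_sum, map_mul, map_prod, MvPolynomial.eval_C, MvPolynomial.eval_X]
    refine Finset.sum_congr rfl fun r _ => ?_
    rw [M.map_smul_univ, smul_eq_mul, mul_comm]

theorem pderiv_comm (i j : Fin n) (w : MvPolynomial (Fin n) ℝ) :
    MvPolynomial.pderiv i (MvPolynomial.pderiv j w)
      = MvPolynomial.pderiv j (MvPolynomial.pderiv i w) := by
  have h : ⁅MvPolynomial.pderiv (R := ℝ) i, MvPolynomial.pderiv (R := ℝ) j⁆ = 0 :=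
    MvPolynomial.derivation_ext fun l => by
      simp only [Derivation.commutator_apply, MvPolynomial.pderiv_X, Pi.single_apply]
      split_ifs <;> simp
  have h1 := congrArg (fun D : Derivation ℝ _ _ => D w) h
  simpa [Derivation.commutator_apply, sub_eq_zero] using h1

/-- In dimension at least `2` there are nonzero harmonic homogeneous polynomials of each degree,
the real parts of the powers of `X₀ + i X₁`. -/
theorem exists_mem_harmonicPoly_ne_zero (hn : 2 ≤ n) (k : ℕ) : ∃ w ∈ harmonicPoly n k, w ≠ 0 := by
  let a : Fin n := ⟨0, by omega⟩
  let b : Fin n := ⟨1, by omega⟩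
  have hab : a ≠ b := by simp [a, b]
  -- real and imaginary parts `p`, `q`, with the Cauchy–Riemann equations
  obtain ⟨p, q, hp, -, haa, hba, hrest, hev, -⟩ : ∃ p q : MvPolynomial (Fin n) ℝ,
      p.IsHomogeneous k ∧ q.IsHomogeneous k ∧
      MvPolynomial.pderiv a p = MvPolynomial.pderiv b q ∧
      MvPolynomial.pderiv b p = -MvPolynomial.pderiv a q ∧
      (∀ i, i ≠ a → i ≠ b → MvPolynomial.pderiv i p = 0 ∧ MvPolynomial.pderiv i q = 0) ∧
      MvPolynomial.eval (Pi.single a 1) p = 1 ∧ MvPolynomial.eval (Pi.single a 1) q = 0 := by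
    induction k with
    | zero =>
      exact ⟨1, 0, MvPolynomial.isHomogeneous_one _ _, MvPolynomial.isHomogeneous_zero _ _ _,
        by simp, by simp, by simp, by simp, by simp⟩
    | succ k ih =>
      obtain ⟨p, q, hp, hq, h1, h2, h3, h4, h5⟩ := ih
      have hXa := MvPolynomial.isHomogeneous_X ℝ a
      have hXb := MvPolynomial.isHomogeneous_X ℝ b
      refine ⟨p * MvPolynomial.X a - q * MvPolynomial.X b,
        p * MvPolynomial.X b + q * MvPolynomial.X a, (hp.mul hXa).sub (hq.mul hXb),
        (hp.mul hXb).add (hq.mul hXa), ?_, ?_, fun i hia hib => ?_, ?_, ?_⟩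
      · simp [MvPolynomial.pderiv_X, hab, hab.symm, h1, h2]
        ring
      · simp [MvPolynomial.pderiv_X, hab, hab.symm, h1, h2]
        ring
      · simp [MvPolynomial.pderiv_X, (h3 i hia hib).1, (h3 i hia hib).2, hia.symm,
          hib.symm]
      · simp [h4, h5]
      · simp [h4, h5, hab.symm]
  refine ⟨p, mem_harmonicPoly_iff.2 ⟨hp, ?_⟩, fun h => by simp [h] at hev⟩
  have hcomm : MvPolynomial.pderiv a (MvPolynomial.pderiv b q)
      = MvPolynomial.pderiv b (MvPolynomial.pderiv a q) :=
    pderiv_comm a b q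
  rw [Finset.sum_eq_add a b hab (fun i _ hi => by rw [(hrest i hi.1 hi.2).1, map_zero])
    (fun h => absurd (Finset.mem_univ a) h) (fun h => absurd (Finset.mem_univ b) h), haa, hba,
    map_neg, hcomm, add_neg_cancel]

instance (k : ℕ) : FiniteDimensional ℝ (harmonicPoly n k) :=
  have hle : harmonicPoly n k ≤ MvPolynomial.restrictTotalDegree (Fin n) ℝ k := fun _ hw =>
    (MvPolynomial.mem_restrictTotalDegree _ _ _).2 (mem_harmonicPoly_iff.1 hw).1.totalDegree_le
  Submodule.finiteDimensional_of_le hle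

end Polynomials

section Eigenfunctions

open Set

variable {n : ℕ} {f : EuclideanSpace ℝ (Fin n) → ℝ} {x : EuclideanSpace ℝ (Fin n)}

theorem laplacianWithin_eq_laplacian_of_contDiff (hf : ContDiff ℝ 2 f) (hx : x ∈ unitBall n) :
    (Δ[unitBall n] f) x = Δ f x := by
  rw [laplacianWithin_eq_iteratedFDerivWithin_stdOrthonormalBasis f (uniqueDiffOn_unitBall n) hx,
    laplacian_eq_iteratedFDeriv_stdOrthonormalBasis]
  simp only [iteratedFDerivWithin_eq_iteratedFDeriv (uniqueDiffOn_unitBall n) hf.contDiffAt hx]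

theorem normalDeriv_eq_euler_of_differentiable (hf : Differentiable ℝ f) (hx : x ∈ unitBall n) :
    normalDeriv f x = euler f x := by
  rw [normalDeriv, (hf x).fderivWithin (uniqueDiffOn_unitBall n x hx), euler]

theorem fderivWithin_fderivWithin_of_contDiff (hf : ContDiff ℝ 2 f) (hx : x ∈ unitBall n) :
    fderivWithin ℝ (fderivWithin ℝ f (unitBall n)) (unitBall n) x = fderiv ℝ (fderiv ℝ f) x := by
  have h : ∀ y ∈ unitBall n, fderivWithin ℝ f (unitBall n) y = fderiv ℝ f y := fun y hy =>
    (hf.differentiable (by norm_num) y).fderivWithin (uniqueDiffOn_unitBall n y hy)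
  rw [fderivWithin_congr h (h x hx)]
  exact ((hf.fderiv_right (m := 1) (by norm_num)).differentiable (by norm_num) x).fderivWithin
    (uniqueDiffOn_unitBall n x hx)

/-- The spherical harmonics are eigenfunctions of the Laplacian of the sphere. -/
theorem sphereLaplacian_polyFun {k : ℕ} {w : MvPolynomial (Fin n) ℝ} (hw : w ∈ harmonicPoly n k)
    (hx : x ∈ unitSphere n) :
    sphereLaplacian (polyFun w) x = -(k * (k + n - 2)) * polyFun w x := by
  have hW : ContDiff ℝ 2 (polyFun w) := (contDiff_polyFun w).of_le (by norm_cast)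
  have hx' : x ∈ unitBall n := sphere_subset_closedBall hx
  have hE := euler_polyFun (mem_harmonicPoly_iff.1 hw).1
  have hEE : euler (euler (polyFun w)) x = k * (k * polyFun w x) := by
    have : euler (polyFun w) = fun x => k * polyFun w x := funext hE
    rw [this, euler_const_mul (hW.differentiable (by norm_num) x), hE]
  have hN : fderivWithin ℝ (polyFun w) (unitBall n) x x = k * polyFun w x := by
    rw [← hE]
    exact normalDeriv_eq_euler_of_differentiable (hW.differentiable (by norm_num)) hx'
  rw [sphereLaplacian_eq hW.contDiffOn hx, laplacianWithin_eq_laplacian_of_contDiff hW hx',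
    laplacian_polyFun_eq_zero hw, fderivWithin_fderivWithin_of_contDiff hW hx',
    fderiv_fderiv_apply_self hW.contDiffAt, hEE, hE, hN]
  ring

/-- The eigenfunction `-2w + k(|x|² - 1)w` of the Wentzell problem that belongs to a harmonic
homogeneous polynomial `w` of degree `k`. -/
noncomputable def eigenfunction (k : ℕ) (w : MvPolynomial (Fin n) ℝ)
    (x : EuclideanSpace ℝ (Fin n)) : ℝ :=
  -2 * polyFun w x + k * (‖x‖ ^ 2 - 1) * polyFun w x

theorem isSolution_eigenfunction (β : ℝ) {k : ℕ} {w : MvPolynomial (Fin n) ℝ}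
    (hw : w ∈ harmonicPoly n k) : IsSolution n β (eigenvalue n β k) (eigenfunction k w) := by
  have hW := contDiff_polyFun w
  have hW2 : ContDiff ℝ 2 (polyFun w) := hW.of_le (by norm_cast)
  have hWd : Differentiable ℝ (polyFun w) := hW2.differentiable (by norm_num)
  have hE := euler_polyFun (mem_harmonicPoly_iff.1 hw).1
  have hp : ContDiff ℝ ∞ fun x => (‖x‖ ^ 2 - 1) * polyFun w x := contDiff_normSq_sub_one.mul hW
  have hfun : eigenfunction k w
      = fun x => -2 * polyFun w x + k * ((‖x‖ ^ 2 - 1) * polyFun w x) :=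
    funext fun x => by rw [eigenfunction]; ring
  have hu : ContDiff ℝ ∞ (eigenfunction k w) := by
    rw [hfun]
    exact (contDiff_const.mul hW).add (contDiff_const.mul hp)
  have hΔ : Δ (eigenfunction k w) = fun x => k * (2 * n + 4 * k) * polyFun w x := by
    funext x
    have h1 : Δ (eigenfunction k w) x = (-2 : ℝ) • Δ (polyFun w) x
        + (k : ℝ) • Δ (fun x => (‖x‖ ^ 2 - 1) * polyFun w x : EuclideanSpace ℝ (Fin n) → ℝ) x := by
      rw [hfun, ← laplacian_smul _ hW2.contDiffAt,
        ← laplacian_smul _ (hp.contDiffAt.of_le (by norm_cast))]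
      exact (contDiff_const.mul hW2).contDiffAt.laplacian_add
        ((contDiff_const.mul (hp.of_le (by norm_cast))).contDiffAt)
    rw [h1, laplacian_normSq_sub_one_mul hW2.contDiffAt, laplacian_polyFun_eq_zero hw, hE,
      finrank_euclideanSpace, Fintype.card_fin]
    simp only [smul_eq_mul]
    ring
  refine ⟨hu.contDiffOn.of_le (by norm_cast), hu.contDiffOn.of_le (by norm_cast), fun x hx => ?_,
    fun x hx => ?_, fun x hx => ?_⟩
  · rw [hΔ]
    exact laplacian_const_mul_eq_zero hW.contDiffOn (fun y _ => laplacian_polyFun_eq_zero hw y) _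
      x hx
  · rw [normalDeriv_eq_euler_of_differentiable (hu.differentiable (by simp))
      (sphere_subset_closedBall hx), hfun, euler_add ((hWd x).const_mul _)
      ((hp.differentiable (by simp) x).const_mul _), euler_const_mul (hWd x),
      euler_const_mul (hp.differentiable (by simp) x), euler_normSq_sub_one_mul (hWd x), hE,
      mem_sphere_zero_iff_norm.1 hx]
    ring
  · have hx' : x ∈ unitBall n := sphere_subset_closedBall hx
    have h1 : normalDeriv (Δ[unitBall n] (eigenfunction k w)) x
        = k * (2 * n + 4 * k) * (k * polyFun w x) := by
      rw [normalDeriv_congr (g := fun x => k * (2 * n + 4 * k) * polyFun w x) (fun y hy => by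
        rw [laplacianWithin_eq_laplacian_of_contDiff (hu.of_le (by norm_cast)) hy, hΔ]) hx',
        normalDeriv_eq_euler_of_differentiable (hWd.const_mul _) hx', euler_const_mul (hWd x), hE]
    have hneg : ∀ y ∈ unitSphere n,
        eigenfunction k w y = polyFun (MvPolynomial.C (-2) * w) y := fun y hy => by
      rw [eigenfunction, mem_sphere_zero_iff_norm.1 hy]
      simp [polyFun]
    have hw2 : MvPolynomial.C (-2) * w ∈ harmonicPoly n k := by
      rw [← MvPolynomial.smul_eq_C_mul]
      exact (harmonicPoly n k).smul_mem _ hw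
    rw [h1, sphereLaplacian_congr hneg hx, sphereLaplacian_polyFun hw2 hx, ← hneg x hx,
      eigenfunction, mem_sphere_zero_iff_norm.1 hx, eigenvalue]
    ring

end Eigenfunctions

/-! ### The eigenspaces -/

section Classification

open Set

variable {n : ℕ} {β ς : ℝ} {u : EuclideanSpace ℝ (Fin n) → ℝ}

theorem strictMono_eigenvalue (hn : 2 ≤ n) (hβ : 0 ≤ β) : StrictMono (eigenvalue n β) := by
  intro j k hjk
  have h1 : (j : ℝ) < k := by exact_mod_cast hjk
  have h2 : (2 : ℝ) ≤ n := by exact_mod_cast hn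
  have h3 : (0 : ℝ) ≤ j := j.cast_nonneg
  have h4 : (j : ℝ) ^ 2 * (n + 2 * j) < (k : ℝ) ^ 2 * (n + 2 * k) := by
    gcongr
  have h5 : β * j * (j + n - 2) ≤ β * k * (k + n - 2) := by
    have h6 : (0 : ℝ) ≤ j + n - 2 := by linarith
    gcongr
  exact add_lt_add_of_lt_of_le h4 h5

theorem eigenvalue_eq (n : ℕ) (β : ℝ) (j : ℕ) :
    2 * (j : ℝ) ^ 3 + (n + β) * j ^ 2 + β * (n - 2) * j = eigenvalue n β j := by
  rw [eigenvalue]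
  ring

theorem eqOn_unitBall_of_eqOn_ball {f g : EuclideanSpace ℝ (Fin n) → ℝ}
    (hf : ContinuousOn f (unitBall n)) (hg : ContinuousOn g (unitBall n))
    (h : ∀ x ∈ ball 0 1, f x = g x) : ∀ x ∈ unitBall n, f x = g x :=
  EqOn.of_subset_closure h hf hg ball_subset_closedBall (closure_ball _ one_ne_zero).ge

/-- The equation of the harmonic function `h` in terms of the Euler operator, along a ray. -/
theorem euler_equation_comp_ray {a b c : ℝ} {h : EuclideanSpace ℝ (Fin n) → ℝ}
    (hh : ContDiffOn ℝ ∞ h (ball 0 1))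
    (heq : ∀ x ∈ ball 0 1, 2 * euler (euler (euler h)) x + a * euler (euler h) x
      + b * euler h x = c * h x) (x : EuclideanSpace ℝ (Fin n)) :
    ∀ t ∈ {t : ℝ | t • x ∈ ball 0 1},
      2 * euler (euler (euler fun t : ℝ => h (t • x))) t
        + a * euler (euler fun t : ℝ => h (t • x)) t + b * euler (fun t : ℝ => h (t • x)) t
        = c * h (t • x) := by
  have hs := isOpen_ray_preimage x
  have hd {f : EuclideanSpace ℝ (Fin n) → ℝ} (hf : ContDiffOn ℝ ∞ f (ball 0 1)) (t : ℝ)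
      (ht : t ∈ {t : ℝ | t • x ∈ ball 0 1}) :
      euler (fun t : ℝ => f (t • x)) t = euler f (t • x) :=
    euler_comp_ray ((hf.contDiffAt_of_isOpen isOpen_ball ht).differentiableAt (by simp))
  have h1 := contDiffOn_euler isOpen_ball hh
  have h2 := contDiffOn_euler isOpen_ball h1
  have e1 := hd hh
  have e2 (t) (ht : t ∈ {t : ℝ | t • x ∈ ball 0 1}) :
      euler (euler fun t : ℝ => h (t • x)) t = euler (euler h) (t • x) := by
    rw [euler_congr_of_isOpen hs e1 ht, hd h1 t ht]
  have e3 (t) (ht : t ∈ {t : ℝ | t • x ∈ ball 0 1}) :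
      euler (euler (euler fun t : ℝ => h (t • x))) t = euler (euler (euler h)) (t • x) := by
    rw [euler_congr_of_isOpen hs e2 ht, hd h2 t ht]
  intro t ht
  rw [e1 t ht, e2 t ht, e3 t ht, heq _ ht]

theorem IsSolution.eq_zero_of_forall_ne (hn : 1 ≤ n) (hu : IsSolution n β ς u)
    (hς : ∀ k : ℕ, ς ≠ eigenvalue n β k) : ∀ x ∈ unitBall n, u x = 0 := by
  obtain ⟨h, hh, -, hdec, heq⟩ := hu.exists_harmonic hn
  have h0 (x) (hx : x ∈ ball (0 : EuclideanSpace ℝ (Fin n)) 1) : h x = 0 := by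
    have h1 := eq_zero_of_euler_equation_of_forall_ne (isOpen_ray_preimage x)
      (Icc_subset_ray_preimage hx) (contDiffOn_comp_ray hh x) (euler_equation_comp_ray hh heq x)
      fun j => by rw [eigenvalue_eq]; exact (hς j).symm
    simpa using h1
  refine eqOn_unitBall_of_eqOn_ball hu.contDiffOn.continuousOn continuousOn_const fun x hx => ?_
  have h2 : euler h x = euler (fun _ => (0 : ℝ)) x := euler_congr_of_isOpen isOpen_ball h0 hx
  rw [hdec x hx, h0 x hx, h2]
  simp [euler]

theorem IsSolution.exists_eq_eigenfunction (hn : 2 ≤ n) (hβ : 0 ≤ β) {k : ℕ}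
    (hu : IsSolution n β (eigenvalue n β k) u) :
    ∃ w ∈ harmonicPoly n k, ∀ x ∈ unitBall n, u x = eigenfunction k w x := by
  obtain ⟨h, hh, hΔ, hdec, heq⟩ := hu.exists_harmonic (by omega)
  obtain ⟨p, hp, hpM⟩ := exists_polyFun_eq_multilinear (iteratedFDeriv ℝ k h 0)
  -- `h` is the homogeneous part of degree `k` of its Taylor expansion at the origin
  have hhom (x) (hx : x ∈ ball (0 : EuclideanSpace ℝ (Fin n)) 1) :
      h x = ((k.factorial : ℝ)⁻¹) * polyFun p x := by
    have h1 := eq_iteratedDeriv_of_euler_equation (isOpen_ray_preimage x)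
      (Icc_subset_ray_preimage hx) (contDiffOn_comp_ray hh x) (euler_equation_comp_ray hh heq x)
      (k := k) fun j => by rw [eigenvalue_eq, (strictMono_eigenvalue hn hβ).injective.eq_iff]
    rw [iteratedDeriv_comp_ray_zero hh, one_smul] at h1
    rw [h1, hpM]
    field_simp
  let w : MvPolynomial (Fin n) ℝ := (-(1 / 2) * (k.factorial : ℝ)⁻¹) • p
  have hw : w.IsHomogeneous k :=
    (MvPolynomial.homogeneousSubmodule (Fin n) ℝ k).smul_mem _ hp
  have hwh (x) (hx : x ∈ ball (0 : EuclideanSpace ℝ (Fin n)) 1) :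
      polyFun w x = -(1 / 2) * h x := by
    rw [hhom x hx]
    simp only [polyFun, w, MvPolynomial.smul_eval]
    ring
  have hmem : w ∈ harmonicPoly n k := mem_harmonicPoly_of_laplacian_eq_zero hw fun x hx => by
    have h1 : polyFun w =ᶠ[𝓝 x] fun y => -(1 / 2) * h y := by
      filter_upwards [isOpen_ball.mem_nhds hx] with y hy using hwh y hy
    rw [(laplacian_congr_nhds h1).eq_of_nhds]
    exact laplacian_const_mul_eq_zero hh hΔ _ x hx
  refine ⟨w, hmem, eqOn_unitBall_of_eqOn_ball hu.contDiffOn.continuousOn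
    (isSolution_eigenfunction β hmem).contDiffOn.continuousOn fun x hx => ?_⟩
  have h1 : ∀ y ∈ ball 0 1, h y = -2 * polyFun w y := fun y hy => by
    rw [hwh y hy]; ring
  rw [hdec x hx, euler_congr_of_isOpen isOpen_ball h1 hx,
    euler_const_mul ((contDiff_polyFun w).differentiable (by simp) x), euler_polyFun hw,
    h1 x hx, eigenfunction]
  ring

end Classification

section Eigenspace

variable {n : ℕ} {β ς : ℝ} {k : ℕ}

theorem extendByZero_apply (u : unitBall n → ℝ) (x : unitBall n) :
    Function.ExtendByZero.linearMap ℝ (Subtype.val : unitBall n → _) u x = u x :=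
  Subtype.val_injective.extend_apply u 0 x

theorem mem_eigenspace_iff {u : unitBall n → ℝ} : u ∈ eigenspace n β ς ↔
    IsSolution n β ς (Function.ExtendByZero.linearMap ℝ (Subtype.val : unitBall n → _) u) :=
  Iff.rfl

theorem mem_eigenspace_of_isSolution {u : EuclideanSpace ℝ (Fin n) → ℝ}
    (hu : IsSolution n β ς u) : (fun x : unitBall n => u x) ∈ eigenspace n β ς :=
  mem_eigenspace_iff.2 (hu.congr fun y hy =>
    extendByZero_apply (fun x : unitBall n => u x) ⟨y, hy⟩)

theorem mem_eigenspace_eigenvalue_iff (hn : 2 ≤ n) (hβ : 0 ≤ β) {u : unitBall n → ℝ} :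
    u ∈ eigenspace n β (eigenvalue n β k) ↔
      ∃ w ∈ harmonicPoly n k, ∀ x : unitBall n, u x = eigenfunction k w x := by
  refine ⟨fun hu => ?_, ?_⟩
  · obtain ⟨w, hw, h⟩ := (mem_eigenspace_iff.1 hu).exists_eq_eigenfunction hn hβ
    exact ⟨w, hw, fun x => by rw [← h x x.2, extendByZero_apply]⟩
  · rintro ⟨w, hw, h⟩
    rw [show u = fun x : unitBall n => eigenfunction k w x from funext h]
    exact mem_eigenspace_of_isSolution (isSolution_eigenfunction β hw)

/-- A harmonic polynomial `w` is determined by the values of `-2w + k(|x|² - 1)w` in the ball, as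
the factor `-2 + k(|x|² - 1)` has no zero there. -/
theorem eq_zero_of_eigenfunction_eq_zero {w : MvPolynomial (Fin n) ℝ}
    (h : ∀ x ∈ ball 0 1, eigenfunction k w x = 0) : w = 0 := by
  refine eq_zero_of_polyFun_eq_zero fun x hx => ?_
  have h1 : (-2 + k * (‖x‖ ^ 2 - 1)) * polyFun w x = 0 := by
    rw [← h x hx, eigenfunction]
    ring
  refine (mul_eq_zero.1 h1).resolve_left (ne_of_lt ?_)
  have h2 : ‖x‖ ^ 2 ≤ 1 := pow_le_one₀ (norm_nonneg x) (mem_ball_zero_iff.1 hx).le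
  have h3 : (k : ℝ) * (‖x‖ ^ 2 - 1) ≤ 0 :=
    mul_nonpos_of_nonneg_of_nonpos k.cast_nonneg (by linarith)
  linarith

/-- The linear map from harmonic homogeneous polynomials to eigenfunctions. -/
noncomputable def eigenfunctionMap (n : ℕ) (β : ℝ) (k : ℕ) :
    harmonicPoly n k →ₗ[ℝ] eigenspace n β (eigenvalue n β k) where
  toFun w := ⟨fun x => eigenfunction k w.1 x,
    mem_eigenspace_of_isSolution (isSolution_eigenfunction β w.2)⟩
  map_add' w₁ w₂ := by
    ext x
    simp [eigenfunction, polyFun]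
    ring
  map_smul' c w := by
    ext x
    simp [eigenfunction, polyFun]
    ring

theorem bijective_eigenfunctionMap (hn : 2 ≤ n) (hβ : 0 ≤ β) (k : ℕ) :
    Function.Bijective (eigenfunctionMap n β k) := by
  refine ⟨(injective_iff_map_eq_zero _).2 fun w hw => Subtype.ext ?_, fun u => ?_⟩
  · refine eq_zero_of_eigenfunction_eq_zero (k := k) fun x hx => ?_
    exact congrFun (congrArg Subtype.val hw) ⟨x, ball_subset_closedBall hx⟩
  · obtain ⟨w, hw, h⟩ := (mem_eigenspace_eigenvalue_iff hn hβ).1 u.2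
    exact ⟨⟨w, hw⟩, Subtype.ext (funext fun x => (h x).symm)⟩

theorem isEigenvalue_iff (hn : 2 ≤ n) (hβ : 0 ≤ β) :
    IsEigenvalue n β ς ↔ ∃ k : ℕ, ς = eigenvalue n β k := by
  constructor
  · rintro ⟨u, hu, hu0⟩
    by_contra! hς
    refine hu0 (funext fun x => ?_)
    rw [← extendByZero_apply u x]
    exact (mem_eigenspace_iff.1 hu).eq_zero_of_forall_ne (by omega) hς x x.2
  · rintro ⟨k, rfl⟩
    obtain ⟨w, hw, hw0⟩ := exists_mem_harmonicPoly_ne_zero hn k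
    refine ⟨_, (eigenfunctionMap n β k ⟨w, hw⟩).2, fun h => hw0 ?_⟩
    have h1 : eigenfunctionMap n β k ⟨w, hw⟩ = 0 := Subtype.ext h
    have h2 := (injective_iff_map_eq_zero _).1 (bijective_eigenfunctionMap hn hβ k).1 _ h1
    exact congrArg Subtype.val h2

end Eigenspace

end Wentzell

theorem theorem1p5 (n : ℕ) (hn : 2 ≤ n) (β : ℝ) (hβ : 0 ≤ β) :
    (∀ ς : ℝ, Wentzell.IsEigenvalue n β ς ↔ ∃ k : ℕ, ς = Wentzell.eigenvalue n β k) ∧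
    (∀ k : ℕ,
      FiniteDimensional ℝ (Wentzell.eigenspace n β (Wentzell.eigenvalue n β k)) ∧
      Module.finrank ℝ (Wentzell.eigenspace n β (Wentzell.eigenvalue n β k)) =
        Module.finrank ℝ (Wentzell.harmonicPoly n k)) ∧
    (∀ k : ℕ,
      (Wentzell.eigenspace n β (Wentzell.eigenvalue n β k) : Set (Wentzell.unitBall n → ℝ)) =
        {u | ∃ w ∈ Wentzell.harmonicPoly n k, ∀ x : Wentzell.unitBall n,
          u x = -2 * MvPolynomial.eval (fun i => x.1 i) w +
            k * (‖x.1‖ ^ 2 - 1) * MvPolynomial.eval (fun i => x.1 i) w}) := by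
  refine ⟨fun ς => Wentzell.isEigenvalue_iff hn hβ, fun k => ?_, fun k => Set.ext fun u =>
    Wentzell.mem_eigenspace_eigenvalue_iff hn hβ⟩
  let e := LinearEquiv.ofBijective _ (Wentzell.bijective_eigenfunctionMap hn hβ k)
  exact ⟨e.finiteDimensional, e.finrank_eq.symm⟩
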